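/- Let $d\ge 1$ and $n\ge d+2$, and let $\xi_1,\dots,\xi_n$ be random vectors in $\mathbb R^d$ (on a common probability space) with partial sums $S_i=\xi_1+\dots+\xi_i$, $1\le i\le n$. Assume: (Br) $S_n=0$ almost surely; (Ex) $(\xi_{\sigma(1)},\dots,\xi_{\sigma(n)})\overset{d}{=}(\xi_1,\dots,\xi_n)$ for every permutation $\sigma$ of $\{1,\dots,n\}$; (GP$'$) for all $1\le i_1<\dots<i_d\le n-1$, the vectors $S_{i_1},\dots,S_{i_d}$ are linearly dependent with probability $0$. For $1\le k\le n-1$ put $$M_{n,k}^{(d)}=\frac12\sum_{1\le i_1<\dots<i_k\le n-1}\mathbf 1_{\{0\notin \mathrm{Conv}(S_{i_1},\dots,S_{i_k})\}} .$$ Let ${k+1 \brack j}$ be the (unsigned) Stirling numbers of the first kind, $t(t+1)\cdots(t+k)=\sum_{j=1}^{k+1}{k+1\brack j}t^j$, with ${k+1\brack j}=0$ for $j\le 0$ and for $j>k+1$. Then for every $k=1,\dots,n-1$, $$\mathbb E M_{n,k}^{(d)}=\frac1{(k+1)!}\binom{n-1}{k}\left({k+1\brack d}+{k+1\brack d-2}+{k+1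 \brack d-4}+\cdots\right)=\binom{n-1}{k}\,\mathbb E M_{k+1,k}^{(d)},$$ where $M_{k+1,k}^{(d)}$ is the analogous quantity for an arbitrary random bridge $T_1,\dots,T_{k+1}$ in $\mathbb R^d$ with $k+1$ increments (possibly on another probability space) that satisfies (Br) and (Ex) with $k+1$ in place of $n$ and is in general position: any $\min(d,k)$ of the vectors $T_1,\dots,T_k$ are linearly dependent with probability $0$ (for $k\ge d$ this is (GP$'$) with $k+1$ in place of $n$). Moreover, if $d=1$, then the number $N_n$ of positive terms among $S_1,\dots,S_{n-1}$ is uniformly distributed: $\mathbb P[N_n=m]=\frac1n$ for $m=0,\dots,n-1$. -/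

import Mathlib

namespace RandomBridge

open MeasureTheory ProbabilityTheory

/-- The partial sum `S_i = ξ_1 + … + ξ_i`; the increments `ξ_1, …, ξ_n` are indexed by `Fin n`,
so these are the increments with (zero-based) index `< i`. -/
def partialSum {Ω : Type*} {d n : ℕ} (ξ : Fin n → Ω → EuclideanSpace ℝ (Fin d))
    (i : ℕ) (ω : Ω) : EuclideanSpace ℝ (Fin d) :=
  ∑ j : Fin n with j.val < i, ξ j ω

/-- Bridge property: `S_n = 0` almost surely. -/
def IsBridge {Ω : Type*} [MeasurableSpace Ω] {d n : ℕ} (P : Measure Ω)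
    (ξ : Fin n → Ω → EuclideanSpace ℝ (Fin d)) : Prop :=
  ∀ᵐ ω ∂P, partialSum ξ n ω = 0

/-- Exchangeability: `(ξ_{σ(1)}, …, ξ_{σ(n)})` has the law of `(ξ_1, …, ξ_n)` for every
permutation `σ`. -/
def IsExchangeable {Ω : Type*} [MeasurableSpace Ω] {d n : ℕ} (P : Measure Ω)
    (ξ : Fin n → Ω → EuclideanSpace ℝ (Fin d)) : Prop :=
  ∀ σ : Equiv.Perm (Fin n),
    IdentDistrib (fun ω i => ξ (σ i) ω) (fun ω i => ξ i ω) P P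

/-- For all `1 ≤ i_1 < … < i_m ≤ n - 1`, the probability that `S_{i_1}, …, S_{i_m}` are linearly
dependent is zero. -/
def InGeneralPosition {Ω : Type*} [MeasurableSpace Ω] {d n : ℕ} (P : Measure Ω)
    (ξ : Fin n → Ω → EuclideanSpace ℝ (Fin d)) (m : ℕ) : Prop :=
  ∀ I ∈ (Finset.Icc 1 (n - 1)).powersetCard m,
    P {ω | ¬ LinearIndependent ℝ (fun i : I => partialSum ξ i ω)} = 0

open Classical in
/-- The random variable `M_{n,k}`: half the number of collections `1 ≤ i_1 < … < i_k ≤ n - 1`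
with `0 ∉ Conv(S_{i_1}, …, S_{i_k})`. -/
noncomputable def halfCount {Ω : Type*} {d n : ℕ} (ξ : Fin n → Ω → EuclideanSpace ℝ (Fin d))
    (k : ℕ) (ω : Ω) : ℝ :=
  (1 / 2) * ∑ I ∈ (Finset.Icc 1 (n - 1)).powersetCard k,
    if (0 : EuclideanSpace ℝ (Fin d)) ∉
      convexHull ℝ ((fun i => partialSum ξ i ω) '' (I : Set ℕ)) then 1 else 0

/-- The sum `[m, d] + [m, d-2] + [m, d-4] + …` of Stirling numbers of the first kind over the
indices `d - 2j ≥ 0`. -/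
def stirlingSum (m d : ℕ) : ℕ :=
  ∑ j ∈ Finset.range (d / 2 + 1), Nat.stirlingFirst m (d - 2 * j)

open Classical in
/-- The number of indices `1 ≤ i ≤ n - 1` such that the coordinate `c` of `S_i` is positive;
in dimension one, the number of positive terms among `S_1, …, S_{n-1}`. -/
noncomputable def positiveCount {Ω : Type*} {d n : ℕ}
    (ξ : Fin n → Ω → EuclideanSpace ℝ (Fin d)) (c : Fin d) (ω : Ω) : ℕ :=
  ((Finset.Icc 1 (n - 1)).filter fun i => 0 < partialSum ξ i ω c).card

end RandomBridge

/-!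
The indices `i₁ < ⋯ < i_k` cut the increments into `k + 1` consecutive blocks, and
`S_{i₁}, …, S_{i_k}` are the proper prefix sums of the walk whose steps are the block sums. By
exchangeability, the same steps taken in another order have the law of the steps of another choice
of indices. So in the expectation each walk may be averaged over the `(k + 1)!` orders of its
steps, and the number of orders whose hull misses `0` turns out to be deterministic.

Summation by parts identifies the relations between the proper prefix sums of a bridge with the
relations `u` between its steps, the coefficients being the differences `u p - u (p + 1)`. Hence `0`
lies in the hull iff the space of relations between the steps contains a nonconstant antitone
vector, and general position allows this vector to be perturbed to a strictly antitone one. So the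
orders whose hull contains `0` correspond to the chambers of the braid arrangement that meet the
space of relations. This space is in general position with respect to the arrangement, and
deletion–restriction counts the chambers through Stirling numbers.

In dimension one, the sums along the cyclic shifts of a bridge are the differences `S_i - S_r`, and
the number of positive ones is the number of `i` with `S_i > S_r`. As the `S_i` are almost surely
distinct, each of the values `0, …, n - 1` is attained for exactly one of the `n` shifts.
-/

namespace RandomBridge

open Finset MeasureTheory ProbabilityTheory
open scoped Topology

section Arrangement

variable {κ V V' : Type*} [AddCommGroup V] [Module ℝ V] [AddCommGroup V'] [Module ℝ V']
  {f : κ → V →ₗ[ℝ] ℝ} {W : Submodule ℝ V} {A s : Finset κ} {a : κ} {v w : V}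

/-- The open polyhedral cone cut out by prescribing the signs of the functionals `f a`, `a ∈ A`:
positive for `a ∈ s` and negative otherwise. -/
def signCone (f : κ → V →ₗ[ℝ] ℝ) (A s : Finset κ) : Set V :=
  {v | ∀ a ∈ A, (a ∈ s → 0 < f a v) ∧ (a ∉ s → f a v < 0)}

open Classical in
/-- The number of regions into which the hyperplanes `f a = 0`, `a ∈ A`, divide `W`; each region
is recorded by the set of those functionals that are positive on it. If some `f a` with `a ∈ A`
vanishes on `W`, then there are none. -/
noncomputable def numRegions (f : κ → V →ₗ[ℝ] ℝ) (W : Submodule ℝ V) (A : Finset κ) : ℕ :=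
  #{s ∈ A.powerset | ((W : Set V) ∩ signCone f A s).Nonempty}

lemma smul_add_smul_mem_signCone (hv : v ∈ signCone f A s) (hw : w ∈ signCone f A s) {p q : ℝ}
    (hp : 0 < p) (hq : 0 < q) : p • v + q • w ∈ signCone f A s := by
  intro a ha
  obtain ⟨hv₁, hv₂⟩ := hv a ha
  obtain ⟨hw₁, hw₂⟩ := hw a ha
  simp only [map_add, map_smul, smul_eq_mul]
  exact ⟨fun h ↦ add_pos (mul_pos hp (hv₁ h)) (mul_pos hq (hw₁ h)),
    fun h ↦ add_neg (mul_neg_of_pos_of_neg hp (hv₂ h)) (mul_neg_of_pos_of_neg hq (hw₂ h))⟩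

lemma exists_add_smul_mem_signCone (hv : v ∈ signCone f A s) (w : V) :
    ∃ ε : ℝ, 0 < ε ∧ v + ε • w ∈ signCone f A s := by
  have hlim (a : κ) : Filter.Tendsto (fun ε : ℝ ↦ f a (v + ε • w)) (𝓝[>] 0) (𝓝 (f a v)) := by
    have : Continuous fun ε : ℝ ↦ f a (v + ε • w) := by
      simp only [map_add, map_smul]
      fun_prop
    simpa using (this.tendsto 0).mono_left nhdsWithin_le_nhds
  have hsign : ∀ᶠ ε in 𝓝[>] (0 : ℝ), v + ε • w ∈ signCone f A s := by
    refine (Filter.eventually_all_finset A).2 fun a ha ↦ ?_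
    by_cases has : a ∈ s
    · filter_upwards [(hlim a).eventually_const_lt ((hv a ha).1 has)] with ε hε
      exact ⟨fun _ ↦ hε, fun h ↦ absurd has h⟩
    · filter_upwards [(hlim a).eventually_lt_const ((hv a ha).2 has)] with ε hε
      exact ⟨fun h ↦ absurd h has, fun _ ↦ hε⟩
  have hpos : ∀ᶠ ε in 𝓝[>] (0 : ℝ), 0 < ε := self_mem_nhdsWithin
  exact (hpos.and hsign).exists

lemma exists_mem_signCone_eq_zero (hvW : v ∈ W) (hv : v ∈ signCone f A s) (hva : 0 < f a v)
    (hwW : w ∈ W) (hw : w ∈ signCone f A s) (hwa : f a w < 0) :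
    ((W ⊓ LinearMap.ker (f a) : Submodule ℝ V) ∩ signCone f A s : Set V).Nonempty := by
  refine ⟨(-f a w) • v + f a v • w, ⟨⟨W.add_mem (W.smul_mem _ hvW) (W.smul_mem _ hwW), ?_⟩, ?_⟩⟩
  · simp only [SetLike.mem_coe, LinearMap.mem_ker, map_add, map_smul, smul_eq_mul]
    ring
  · exact smul_add_smul_mem_signCone hv hw (neg_pos.2 hwa) hva

lemma numRegions_map {κ' : Type*} (e : κ' ↪ κ) (g : κ' → V' →ₗ[ℝ] ℝ) (L : V →ₗ[ℝ] V')
    (h : ∀ a v, f (e a) v = g a (L v)) (A : Finset κ') :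
    numRegions f W (A.map e) = numRegions g (W.map L) A := by
  classical
  have himage : (A.map e).powerset = A.powerset.map (mapEmbedding e).toEmbedding := by
    ext s
    simp [mem_powerset, subset_map_iff, eq_comm]
  have hcone (s : Finset κ') (v : V) :
      v ∈ signCone f (A.map e) (s.map e) ↔ L v ∈ signCone g A s := by
    simp only [signCone, Set.mem_ofPred_eq, forall_mem_map, mem_map', h]
  rw [numRegions, numRegions, card_filter, card_filter, himage, sum_map]
  refine sum_congr rfl fun s _ ↦ if_congr ?_ rfl rfl
  change (∃ v, v ∈ W ∧ v ∈ signCone f (A.map e) (s.map e)) ↔ _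
  simp only [hcone, Set.Nonempty, Set.mem_inter_iff, SetLike.mem_coe, Submodule.mem_map,
    exists_exists_and_eq_and]

variable [DecidableEq κ]

lemma mem_signCone_insert (ha : a ∉ A) (hs : s ⊆ A) :
    v ∈ signCone f (insert a A) s ↔ v ∈ signCone f A s ∧ f a v < 0 := by
  have has : a ∉ s := fun h ↦ ha (hs h)
  simp [signCone, has, and_comm]

lemma mem_signCone_insert_insert (ha : a ∉ A) :
    v ∈ signCone f (insert a A) (insert a s) ↔ v ∈ signCone f A s ∧ 0 < f a v := by
  have hne : ∀ b ∈ A, b ≠ a := fun b hb h ↦ ha (h ▸ hb)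
  simp +contextual [signCone, hne, and_comm]

open Classical in
lemma numRegions_insert_eq_sum (ha : a ∉ A) :
    numRegions f W (insert a A) = ∑ s ∈ A.powerset,
      ((if ∃ v ∈ W, v ∈ signCone f A s ∧ f a v < 0 then 1 else 0) +
        if ∃ v ∈ W, v ∈ signCone f A s ∧ 0 < f a v then 1 else 0) := by
  rw [numRegions, card_filter, sum_powerset_insert ha, ← sum_add_distrib]
  refine sum_congr rfl fun s hs ↦ ?_
  simp only [Set.Nonempty, Set.mem_inter_iff, SetLike.mem_coe,
    mem_signCone_insert ha (mem_powerset.1 hs), mem_signCone_insert_insert ha]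

lemma numRegions_insert (ha : a ∉ A) (hW : ∃ w ∈ W, f a w ≠ 0) :
    numRegions f W (insert a A) =
      numRegions f W A + numRegions f (W ⊓ LinearMap.ker (f a)) A := by
  classical
  obtain ⟨w, hwW, hw⟩ : ∃ w ∈ W, 0 < f a w := by
    obtain ⟨w, hwW, hw⟩ := hW
    rcases hw.lt_or_gt with h | h
    · exact ⟨-w, W.neg_mem hwW, by simpa using h⟩
    · exact ⟨w, hwW, h⟩
  rw [numRegions_insert_eq_sum ha, numRegions, numRegions, card_filter, card_filter,
    ← sum_add_distrib]
  refine sum_congr rfl fun s _ ↦ ?_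
  set pos : Prop := ∃ v ∈ W, v ∈ signCone f A s ∧ 0 < f a v
  set neg : Prop := ∃ v ∈ W, v ∈ signCone f A s ∧ f a v < 0
  set all : Prop := ((W : Set V) ∩ signCone f A s).Nonempty
  set zero : Prop := ((W ⊓ LinearMap.ker (f a) : Submodule ℝ V) ∩ signCone f A s : Set V).Nonempty
  have zero_of_pos_of_neg : pos → neg → zero := by
    rintro ⟨v, hvW, hv, hva⟩ ⟨u, huW, hu, hua⟩
    exact exists_mem_signCone_eq_zero hvW hv hva huW hu hua
  have pos_of_zero : zero → pos := by
    rintro ⟨v, ⟨hvW, hva⟩, hv⟩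
    obtain ⟨ε, hε, hmem⟩ := exists_add_smul_mem_signCone hv w
    refine ⟨_, W.add_mem hvW (W.smul_mem ε hwW), hmem, ?_⟩
    simpa [LinearMap.mem_ker.1 hva] using mul_pos hε hw
  have neg_of_zero : zero → neg := by
    rintro ⟨v, ⟨hvW, hva⟩, hv⟩
    obtain ⟨ε, hε, hmem⟩ := exists_add_smul_mem_signCone hv (-w)
    refine ⟨_, W.add_mem hvW (W.smul_mem ε (W.neg_mem hwW)), hmem, ?_⟩
    simpa [LinearMap.mem_ker.1 hva] using mul_pos hε hw
  have all_iff : all ↔ pos ∨ neg ∨ zero := by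
    constructor
    · rintro ⟨v, hvW, hv⟩
      rcases lt_trichotomy (f a v) 0 with h | h | h
      exacts [.inr (.inl ⟨v, hvW, hv, h⟩), .inr (.inr ⟨v, ⟨hvW, h⟩, hv⟩), .inl ⟨v, hvW, hv, h⟩]
    · rintro (⟨v, hvW, hv, -⟩ | ⟨v, hvW, hv, -⟩ | ⟨v, ⟨hvW, -⟩, hv⟩) <;> exact ⟨v, hvW, hv⟩
  by_cases hp : pos <;> by_cases hn : neg <;> by_cases hz : zero <;> simp_all

lemma numRegions_insert_of_eq_mul {b : κ} (ha : a ∉ A) (hb : b ∈ A) {c : ℝ} (hc : c ≠ 0)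
    (h : ∀ v ∈ W, f a v = c * f b v) : numRegions f W (insert a A) = numRegions f W A := by
  classical
  rw [numRegions_insert_eq_sum ha, numRegions, card_filter]
  refine sum_congr rfl fun s _ ↦ ?_
  have hsign : (∀ v ∈ W, v ∈ signCone f A s → f a v < 0) ∨
      ∀ v ∈ W, v ∈ signCone f A s → 0 < f a v := by
    rcases hc.lt_or_gt with hc | hc <;> by_cases hbs : b ∈ s
    · exact .inl fun v hvW hv ↦ h v hvW ▸ mul_neg_of_neg_of_pos hc ((hv b hb).1 hbs)
    · exact .inr fun v hvW hv ↦ h v hvW ▸ mul_pos_of_neg_of_neg hc ((hv b hb).2 hbs)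
    · exact .inr fun v hvW hv ↦ h v hvW ▸ mul_pos hc ((hv b hb).1 hbs)
    · exact .inl fun v hvW hv ↦ h v hvW ▸ mul_neg_of_pos_of_neg hc ((hv b hb).2 hbs)
  simp only [Set.Nonempty, Set.mem_inter_iff, SetLike.mem_coe]
  rcases hsign with hsign | hsign <;> split_ifs <;> grind

lemma numRegions_union_of_eq_mul {B : Finset κ}
    (h : ∀ a ∈ B, a ∉ A → ∃ b ∈ A, ∃ c : ℝ, c ≠ 0 ∧ ∀ v ∈ W, f a v = c * f b v) :
    numRegions f W (A ∪ B) = numRegions f W A := by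
  induction B using Finset.induction_on with
  | empty => rw [union_empty]
  | insert a B _ ih =>
    have ih := ih fun a' ha' ↦ h a' (mem_insert_of_mem ha')
    rw [union_insert]
    by_cases ha : a ∈ A ∪ B
    · rw [insert_eq_of_mem ha, ih]
    · obtain ⟨b, hb, c, hc, hab⟩ := h a (mem_insert_self a B) fun h ↦ ha (mem_union_left B h)
      rw [numRegions_insert_of_eq_mul ha (mem_union_left B hb) hc hab, ih]

end Arrangement

section Stirling

lemma stirlingSum_zero (m : ℕ) : stirlingSum (m + 1) 0 = 0 := by
  simp [stirlingSum]

lemma stirlingSum_one (m : ℕ) : stirlingSum m 1 = Nat.stirlingFirst m 1 := by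
  simp [stirlingSum]

lemma stirlingSum_add_two (m d : ℕ) :
    stirlingSum m (d + 2) = Nat.stirlingFirst m (d + 2) + stirlingSum m d := by
  have hlen : (d + 2) / 2 + 1 = d / 2 + 1 + 1 := by lia
  have hterm (j : ℕ) : d + 2 - 2 * (j + 1) = d - 2 * j := by lia
  rw [stirlingSum, hlen, sum_range_succ', add_comm]
  simp only [stirlingSum, hterm, mul_zero, tsub_zero]

lemma stirlingSum_succ_succ (m d : ℕ) :
    stirlingSum (m + 2) (d + 1) =
      (m + 1) * stirlingSum (m + 1) (d + 1) + stirlingSum (m + 1) d := by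
  induction d using Nat.twoStepInduction with
  | zero =>
    rw [zero_add, stirlingSum_one, stirlingSum_one, stirlingSum_zero, Nat.stirlingFirst_succ_succ,
      Nat.stirlingFirst_succ_zero]
  | one =>
    rw [stirlingSum_add_two, stirlingSum_add_two, stirlingSum_zero, stirlingSum_zero,
      stirlingSum_one, Nat.stirlingFirst_succ_succ, add_zero, add_zero]
  | more d ih _ =>
    rw [stirlingSum_add_two _ (d + 1), stirlingSum_add_two _ (d + 1), stirlingSum_add_two _ d, ih,
      Nat.stirlingFirst_succ_succ]
    ring

lemma two_mul_stirlingSum_eq_factorial {m d : ℕ} (hm : 2 ≤ m) (hd : m ≤ d + 1) :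
    2 * stirlingSum m d = m.factorial := by
  induction m, hm using Nat.le_induction generalizing d with
  | base =>
    induction d using Nat.twoStepInduction with
    | zero => lia
    | one => simp [stirlingSum_one, Nat.stirlingFirst]
    | more d ih _ =>
      rw [stirlingSum_add_two]
      rcases d with _ | d
      · simp [stirlingSum_zero, Nat.stirlingFirst]
      · rw [mul_add, ih (by lia), Nat.stirlingFirst_eq_zero_of_lt (by lia), mul_zero, zero_add]
  | succ m hm ih =>
    obtain ⟨d, rfl⟩ := Nat.exists_eq_add_of_le' (show 1 ≤ d by lia)
    obtain ⟨m, rfl⟩ := Nat.exists_eq_add_of_le' (show 1 ≤ m by lia)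
    rw [stirlingSum_succ_succ, mul_add, mul_left_comm, ih (by lia), ih (by lia),
      Nat.factorial_succ (m + 1)]
    ring

end Stirling

section Generic

open Module Submodule LinearMap

lemma finrank_map_of_forall_eq_zero {V V' : Type*} [AddCommGroup V] [Module ℝ V] [AddCommGroup V']
    [Module ℝ V'] {f : V →ₗ[ℝ] V'} {W : Submodule ℝ V} (h : ∀ w ∈ W, f w = 0 → w = 0) :
    finrank ℝ (W.map f) = finrank ℝ W := by
  rw [← range_domRestrict]
  refine finrank_range_of_inj ((injective_iff_map_eq_zero _).2 fun w hw ↦ ?_)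
  exact Subtype.ext (h w w.2 hw)

lemma finrank_le_finrank_inf_ker_add_one {V : Type*} [AddCommGroup V] [Module ℝ V]
    [FiniteDimensional ℝ V] (W : Submodule ℝ V) (f : V →ₗ[ℝ] ℝ) :
    finrank ℝ W ≤ finrank ℝ ↥(W ⊓ ker f) + 1 := by
  have hker := f.finrank_range_add_finrank_ker
  have hrange := (range f).finrank_le
  have hsup := finrank_sup_add_finrank_inf_eq W (ker f)
  have hsup_le := (W ⊔ ker f).finrank_le
  rw [finrank_self] at hrange
  lia

variable {ι κ : Type*} {d : ℕ}

/-- A space `W` of real functions on a finite set is `d`-generic if no nonconstant element of `W`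
takes at most `d + 1` values. When `W` has codimension at most `d`, this says that `W` meets
every stratum of the braid arrangement in the smallest possible dimension. -/
def IsGeneric (d : ℕ) (W : Submodule ℝ (ι → ℝ)) : Prop :=
  ∀ w ∈ W, (Set.range w).ncard ≤ d + 1 → ∀ i j, w i = w j

lemma IsGeneric.comap_funLeft {W : Submodule ℝ (ι → ℝ)} (hW : IsGeneric d W) {c : ι → κ}
    (hc : Function.Surjective c) : IsGeneric d (W.comap (funLeft ℝ ℝ c)) := by
  intro w hw hcard p q
  obtain ⟨i, rfl⟩ := hc p
  obtain ⟨j, rfl⟩ := hc q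
  exact hW _ hw (by rwa [← hc.range_comp w] at hcard) i j

lemma finrank_inf_range_funLeft {W : Submodule ℝ (ι → ℝ)} {c : ι → κ}
    (hc : Function.Surjective c) :
    finrank ℝ ↥(W ⊓ range (funLeft ℝ ℝ c)) = finrank ℝ (W.comap (funLeft ℝ ℝ c)) := by
  rw [inf_comm, ← map_comap_eq]
  refine finrank_map_of_forall_eq_zero fun w _ hw ↦ ?_
  exact funLeft_injective_of_surjective ℝ ℝ c hc (by rw [hw, map_zero])

lemma finrank_range_funLeft [Fintype κ] {c : ι → κ} (hc : Function.Surjective c) :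
    finrank ℝ (range (funLeft ℝ ℝ c)) = Fintype.card κ := by
  rw [finrank_range_of_inj (funLeft_injective_of_surjective ℝ ℝ c hc), finrank_fintype_fun_eq_card]

variable [Fintype ι]

lemma IsGeneric.finrank_add_le {W : Submodule ℝ (ι → ℝ)} (hW : IsGeneric d W)
    (hι : d + 1 ≤ Fintype.card ι) : finrank ℝ W + d ≤ Fintype.card ι := by
  obtain ⟨e⟩ : Nonempty (Fin (d + 1) ↪ ι) :=
    Function.Embedding.nonempty_of_card_le (by rwa [Fintype.card_fin])
  have hc := Function.invFun_surjective e.injective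
  have hconst : W.comap (funLeft ℝ ℝ (Function.invFun e)) ≤ span ℝ {1} := by
    intro w hw
    have hvalues : (Set.range w).ncard ≤ d + 1 := by
      rw [← Nat.card_coe_set_eq]
      exact (Finite.card_range_le w).trans_eq (Nat.card_fin _)
    refine mem_span_singleton.2 ⟨w 0, funext fun p ↦ ?_⟩
    simpa using hW.comap_funLeft hc w hw hvalues 0 p
  have hinf : finrank ℝ (W.comap (funLeft ℝ ℝ (Function.invFun e))) ≤ 1 :=
    (finrank_mono hconst).trans ((finrank_span_le_card _).trans (by simp))
  have hsup := finrank_sup_add_finrank_inf_eq W (range (funLeft ℝ ℝ (Function.invFun e)))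
  have hsup_le := (W ⊔ range (funLeft ℝ ℝ (Function.invFun e))).finrank_le
  rw [finrank_inf_range_funLeft hc, finrank_range_funLeft hc, Fintype.card_fin] at hsup
  rw [finrank_fintype_fun_eq_card] at hsup_le
  lia

lemma IsGeneric.sup_range_funLeft_eq_top [Fintype κ] {W : Submodule ℝ (ι → ℝ)}
    (hW : IsGeneric d W) (hι : Fintype.card ι ≤ finrank ℝ W + d) {c : ι → κ}
    (hc : Function.Surjective c) (hκ : d + 1 ≤ Fintype.card κ) :
    W ⊔ range (funLeft ℝ ℝ c) = ⊤ := by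
  have hsup := finrank_sup_add_finrank_inf_eq W (range (funLeft ℝ ℝ c))
  have hinf := (hW.comap_funLeft hc).finrank_add_le hκ
  have hsup_le := (W ⊔ range (funLeft ℝ ℝ c)).finrank_le
  rw [finrank_inf_range_funLeft hc, finrank_range_funLeft hc] at hsup
  refine eq_top_of_finrank_eq ?_
  rw [finrank_fintype_fun_eq_card] at hsup_le ⊢
  lia

end Generic

section Antitone

open Module Submodule LinearMap

variable {d k : ℕ} {W : Submodule ℝ (Fin (k + 1) → ℝ)} {u : Fin (k + 1) → ℝ}

lemma exists_strictAnti_add_smul (hu : Antitone u) {w : Fin (k + 1) → ℝ}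
    (hw : ∀ i : Fin k, u i.succ = u i.castSucc → w i.succ < w i.castSucc) :
    ∃ ε : ℝ, StrictAnti (u + ε • w) := by
  have hstep (i : Fin k) : ∀ᶠ ε : ℝ in 𝓝[>] 0, (u + ε • w) i.succ < (u + ε • w) i.castSucc := by
    simp only [Pi.add_apply, Pi.smul_apply, smul_eq_mul]
    rcases (hu i.castSucc_lt_succ.le).eq_or_lt with h | h
    · filter_upwards [self_mem_nhdsWithin] with ε hε
      rw [h]
      exact add_lt_add_right (mul_lt_mul_of_pos_left (hw i h) hε) _
    · have hlim (j : Fin (k + 1)) : Filter.Tendsto (fun ε : ℝ ↦ u j + ε * w j) (𝓝[>] 0)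
          (𝓝 (u j)) := by
        have : Continuous fun ε : ℝ ↦ u j + ε * w j := by fun_prop
        simpa using (this.tendsto 0).mono_left nhdsWithin_le_nhds
      exact (hlim _).eventually_lt (hlim _) h
  obtain ⟨ε, hε⟩ := (Filter.eventually_all.2 hstep).exists
  exact ⟨ε, Fin.strictAnti_iff_succ_lt.2 hε⟩

lemma IsGeneric.exists_strictAnti (hW : IsGeneric d W) (hd : k + 1 ≤ finrank ℝ W + d)
    (huW : u ∈ W) (hu : Antitone u) (hne : ∃ i j, u i ≠ u j) : ∃ w ∈ W, StrictAnti w := by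
  classical
  have hcard : d + 1 ≤ Fintype.card (Set.range u) := by
    by_contra! hcard
    obtain ⟨i, j, hij⟩ := hne
    exact hij (hW u huW (by rw [← Nat.card_coe_set_eq, Nat.card_eq_fintype_card]; lia) i j)
  have hdecomp : (fun i : Fin (k + 1) ↦ -(i : ℝ)) ∈
      W ⊔ range (funLeft ℝ ℝ (Set.rangeFactorization u)) := by
    rw [hW.sup_range_funLeft_eq_top (by rwa [Fintype.card_fin])
      Set.rangeFactorization_surjective hcard]
    exact mem_top
  obtain ⟨w, hwW, _, ⟨t, rfl⟩, hwt⟩ := Submodule.mem_sup.1 hdecomp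
  obtain ⟨ε, hε⟩ := exists_strictAnti_add_smul hu (w := w) fun i hi ↦ by
    have hfibre : Set.rangeFactorization u i.succ = Set.rangeFactorization u i.castSucc :=
      Subtype.ext hi
    have hsucc := congrFun hwt i.succ
    have hcast := congrFun hwt i.castSucc
    simp only [Pi.add_apply, funLeft_apply, hfibre, Fin.val_succ, Fin.val_castSucc,
      Nat.cast_add, Nat.cast_one] at hsucc hcast
    linarith
  exact ⟨_, W.add_mem huW (W.smul_mem ε hwW), hε⟩

end Antitone

section Tail

open Module Submodule LinearMap

variable {d m : ℕ} {W : Submodule ℝ (Fin (m + 1) → ℝ)}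

/-- The functional `t ↦ t i - t j` attached to the pair `(i, j)`. -/
def coordDiff {ι : Type*} (p : ι × ι) : (ι → ℝ) →ₗ[ℝ] ℝ :=
  LinearMap.proj (R := ℝ) (φ := fun _ ↦ ℝ) p.1 - LinearMap.proj p.2

@[simp]
lemma coordDiff_apply {ι : Type*} (p : ι × ι) (t : ι → ℝ) : coordDiff p t = t p.1 - t p.2 := rfl

/-- The linear map forgetting the first coordinate. -/
def tail (m : ℕ) : (Fin (m + 1) → ℝ) →ₗ[ℝ] (Fin m → ℝ) := funLeft ℝ ℝ Fin.succ

lemma range_eq_insert_range_tail (w : Fin (m + 1) → ℝ) :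
    Set.range w = insert (w 0) (Set.range (tail m w)) :=
  Fin.range_fin_succ w

lemma IsGeneric.map_tail (hW : IsGeneric (d + 1) W) : IsGeneric d (W.map (tail m)) := by
  rintro _ ⟨w, hw, rfl⟩ hcard i j
  refine hW w hw ?_ i.succ j.succ
  rw [range_eq_insert_range_tail]
  exact (Set.ncard_insert_le _ _).trans (by lia)

lemma IsGeneric.finrank_map_tail (hW : IsGeneric (d + 1) W) (hm : m ≠ 0) :
    finrank ℝ (W.map (tail m)) = finrank ℝ W := by
  refine finrank_map_of_forall_eq_zero fun w hw hw0 ↦ ?_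
  have htail (i : Fin m) : w i.succ = 0 := congrFun hw0 i
  have hrange : Set.range w ⊆ {w 0, 0} := by
    rintro _ ⟨i, rfl⟩
    induction i using Fin.cases <;> simp [htail]
  have hconst := hW w hw <|
    (Set.ncard_le_ncard hrange).trans ((Set.ncard_insert_le _ _).trans (by simp))
  exact funext fun i ↦ (hconst i (Fin.succ ⟨0, Nat.pos_of_ne_zero hm⟩)).trans (htail _)

/-- The trace of `W` on the hyperplane where coordinates `0` and `i.succ` agree, as a space of
functions of the remaining coordinates. -/
def collapse (W : Submodule ℝ (Fin (m + 1) → ℝ)) (i : Fin m) : Submodule ℝ (Fin m → ℝ) :=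
  (W ⊓ ker (coordDiff (0, i.succ))).map (tail m)

lemma IsGeneric.collapse (hW : IsGeneric d W) (i : Fin m) : IsGeneric d (collapse W i) := by
  rintro _ ⟨w, ⟨hw, hwi⟩, rfl⟩ hcard j l
  have hmem : w 0 ∈ Set.range (tail m w) := ⟨i, (sub_eq_zero.1 (mem_ker.1 hwi)).symm⟩
  refine hW w hw ?_ j.succ l.succ
  rwa [range_eq_insert_range_tail, Set.insert_eq_of_mem hmem]

lemma finrank_collapse (W : Submodule ℝ (Fin (m + 1) → ℝ)) (i : Fin m) :
    finrank ℝ (collapse W i) = finrank ℝ ↥(W ⊓ ker (coordDiff (0, i.succ))) := by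
  refine finrank_map_of_forall_eq_zero fun w ⟨_, hwi⟩ hw0 ↦ funext fun j ↦ ?_
  have htail (l : Fin m) : w l.succ = 0 := congrFun hw0 l
  induction j using Fin.cases with
  | zero => exact (sub_eq_zero.1 (mem_ker.1 hwi)).trans (htail i)
  | succ j => exact htail j

lemma finrank_le_finrank_collapse_add_one (W : Submodule ℝ (Fin (m + 1) → ℝ)) (i : Fin m) :
    finrank ℝ W ≤ finrank ℝ (collapse W i) + 1 := by
  rw [finrank_collapse]
  exact finrank_le_finrank_inf_ker_add_one W _

lemma IsGeneric.exists_coordDiff_ne_zero (hW : IsGeneric d W) (hm : d + 1 ≤ m)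
    (hd : m + 1 ≤ finrank ℝ W + d) (i : Fin m) : ∃ w ∈ W, coordDiff (0, i.succ) w ≠ 0 := by
  by_contra! hzero
  have hle := (hW.collapse i).finrank_add_le (by rwa [Fintype.card_fin])
  rw [finrank_collapse, inf_eq_left.2 fun w hw ↦ hzero w hw, Fintype.card_fin] at hle
  lia

end Tail

section Chambers

open Module Submodule

variable {d m : ℕ}

lemma eq_of_mem_signCone {κ V : Type*} [AddCommGroup V] [Module ℝ V] {f : κ → V →ₗ[ℝ] ℝ}
    {A s t : Finset κ} {v : V} (hs : s ⊆ A) (ht : t ⊆ A) (hvs : v ∈ signCone f A s)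
    (hvt : v ∈ signCone f A t) : s = t := by
  ext a
  by_cases ha : a ∈ A
  · have := hvs a ha
    have := hvt a ha
    grind [lt_asymm]
  · exact iff_of_false (fun h ↦ ha (hs h)) fun h ↦ ha (ht h)

lemma ne_zero_of_mem_signCone {κ V : Type*} [AddCommGroup V] [Module ℝ V] {f : κ → V →ₗ[ℝ] ℝ}
    {A s : Finset κ} {a : κ} {v : V} (hv : v ∈ signCone f A s) (ha : a ∈ A) : f a v ≠ 0 := by
  by_cases has : a ∈ s
  · exact ((hv a ha).1 has).ne'
  · exact ((hv a ha).2 has).ne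

/-- The number of chambers of the braid arrangement in `ℝ^m` that meet `W`; a chamber is recorded
by the permutation that sorts the coordinates of its points in decreasing order. -/
noncomputable def chamberCount (W : Submodule ℝ (Fin m → ℝ)) : ℕ :=
  open Classical in #{σ : Equiv.Perm (Fin m) | ∃ w ∈ W, StrictAnti (w ∘ σ)}

/-- The index set of the hyperplanes of the braid arrangement in `ℝ^m`. -/
def orderedPairs (m : ℕ) : Finset (Fin m × Fin m) := {p | p.1 < p.2}

lemma mem_orderedPairs {p : Fin m × Fin m} : p ∈ orderedPairs m ↔ p.1 < p.2 := by
  simp [orderedPairs]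

/-- The set of functionals `t i - t j`, `i < j`, that are positive on the chamber of `σ`. -/
def signPattern (σ : Equiv.Perm (Fin m)) : Finset (Fin m × Fin m) :=
  {p ∈ orderedPairs m | σ.symm p.1 < σ.symm p.2}

lemma injective_of_mem_signCone {s : Finset (Fin m × Fin m)} {w : Fin m → ℝ}
    (hw : w ∈ signCone coordDiff (orderedPairs m) s) : Function.Injective w := by
  have hne {i j : Fin m} (hij : i < j) : w i ≠ w j :=
    sub_ne_zero.1 (ne_zero_of_mem_signCone hw (a := (i, j)) (mem_orderedPairs.2 hij))
  intro i j hij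
  by_contra h
  rcases lt_or_gt_of_ne h with h | h
  exacts [hne h hij, hne h hij.symm]

lemma mem_signCone_signPattern {σ : Equiv.Perm (Fin m)} {w : Fin m → ℝ} :
    w ∈ signCone coordDiff (orderedPairs m) (signPattern σ) ↔ StrictAnti (w ∘ σ) := by
  simp only [signCone, signPattern, Set.mem_ofPred_eq, mem_filter, mem_orderedPairs, Prod.forall,
    coordDiff_apply, sub_pos, sub_neg, not_and]
  constructor
  · intro h i j hij
    rcases lt_or_gt_of_ne (σ.injective.ne hij.ne) with hσ | hσ
    · exact (h _ _ hσ).1 ⟨hσ, by simpa⟩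
    · exact (h _ _ hσ).2 fun _ ↦ by simpa using hij.le
  · intro h i j hij
    have hw (a b : Fin m) (hab : σ.symm a < σ.symm b) : w b < w a := by simpa using h hab
    refine ⟨fun hσ ↦ hw _ _ hσ.2, fun hσ ↦ hw _ _ ?_⟩
    exact (not_lt.1 (hσ hij)).lt_of_ne (σ.symm.injective.ne hij.ne')

lemma eq_of_strictAnti_comp {w : Fin m → ℝ} {σ τ : Equiv.Perm (Fin m)} (hσ : StrictAnti (w ∘ σ))
    (hτ : StrictAnti (w ∘ τ)) : σ = τ := by
  have hw : Function.Injective w := by simpa using hσ.injective.comp σ.symm.injective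
  have heq := Tuple.unique_antitone hσ.antitone hτ.antitone
  exact Equiv.ext fun i ↦ hw (congrFun heq i)

lemma exists_perm_strictAnti_comp {α : Type*} [LinearOrder α] {w : Fin m → α}
    (hw : Function.Injective w) : ∃ σ : Equiv.Perm (Fin m), StrictAnti (w ∘ σ) := by
  have hsort := Tuple.monotone_sort (OrderDual.toDual ∘ w)
  exact ⟨_, (monotone_toDual_comp_iff.1 hsort).strictAnti_of_injective
    (hw.comp (Equiv.injective _))⟩

lemma chamberCount_eq_numRegions (W : Submodule ℝ (Fin m → ℝ)) :
    chamberCount W = numRegions coordDiff W (orderedPairs m) := by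
  classical
  refine card_bij (fun σ _ ↦ signPattern σ) ?_ ?_ ?_
  · intro σ hσ
    obtain ⟨w, hw, hwσ⟩ := (mem_filter.1 hσ).2
    exact mem_filter.2 ⟨mem_powerset.2 (filter_subset _ _), w, hw, mem_signCone_signPattern.2 hwσ⟩
  · intro σ hσ τ _ h
    obtain ⟨w, -, hwσ⟩ := (mem_filter.1 hσ).2
    refine eq_of_strictAnti_comp hwσ (mem_signCone_signPattern.1 ?_)
    rw [← h]
    exact mem_signCone_signPattern.2 hwσ
  · intro s hs
    obtain ⟨hsub, w, hw, hws⟩ := mem_filter.1 hs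
    obtain ⟨σ, hσ⟩ := exists_perm_strictAnti_comp (injective_of_mem_signCone hws)
    exact ⟨σ, mem_filter.2 ⟨mem_univ _, w, hw, hσ⟩, eq_of_mem_signCone (filter_subset _ _)
      (mem_powerset.1 hsub) (mem_signCone_signPattern.2 hσ) hws⟩

/-- The index set of those hyperplanes of the braid arrangement that do not involve
coordinate `0`. -/
def succPairs (m : ℕ) : Finset (Fin (m + 1) × Fin (m + 1)) :=
  (orderedPairs m).map ((Fin.succEmb m).prodMap (Fin.succEmb m))

lemma succ_succ_mem_succPairs {i j : Fin m} (hij : i < j) : (i.succ, j.succ) ∈ succPairs m :=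
  mem_map.2 ⟨(i, j), mem_orderedPairs.2 hij, rfl⟩

lemma zero_notMem_succPairs (j : Fin (m + 1)) : (0, j) ∉ succPairs m := by
  simp [succPairs, Fin.succ_ne_zero]

lemma orderedPairs_succ (m : ℕ) :
    orderedPairs (m + 1) = succPairs m ∪ univ.image fun j : Fin m ↦ (0, j.succ) := by
  ext ⟨i, j⟩
  induction i using Fin.cases <;> induction j using Fin.cases <;>
    simp [succPairs, mem_orderedPairs, Fin.succ_ne_zero, (Fin.succ_ne_zero _).symm]

lemma numRegions_succPairs (W : Submodule ℝ (Fin (m + 1) → ℝ)) :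
    numRegions coordDiff W (succPairs m) = chamberCount (W.map (tail m)) := by
  rw [chamberCount_eq_numRegions]
  exact numRegions_map _ _ _ (fun _ _ ↦ rfl) _

lemma exists_succPairs_coordDiff_eq_mul {i j : Fin m} (hij : i ≠ j) :
    ∃ p ∈ succPairs m, ∃ c : ℝ, c ≠ 0 ∧
      ∀ w ∈ LinearMap.ker (coordDiff (0, i.succ)), coordDiff (0, j.succ) w = c * coordDiff p w := by
  simp only [LinearMap.mem_ker, coordDiff_apply, sub_eq_zero]
  rcases lt_or_gt_of_ne hij with h | h
  · refine ⟨_, succ_succ_mem_succPairs h, 1, one_ne_zero, fun w hw ↦ ?_⟩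
    rw [hw, one_mul]
  · refine ⟨_, succ_succ_mem_succPairs h, -1, by simp, fun w hw ↦ ?_⟩
    rw [hw, neg_one_mul, neg_sub]

lemma numRegions_succPairs_union {W : Submodule ℝ (Fin (m + 1) → ℝ)} (J : Finset (Fin m))
    (hW : ∀ i ∈ J, ∃ w ∈ W, coordDiff (0, i.succ) w ≠ 0) :
    numRegions coordDiff W (succPairs m ∪ J.image fun j : Fin m ↦ (0, j.succ)) =
      chamberCount (W.map (tail m)) + ∑ i ∈ J, chamberCount (collapse W i) := by
  induction J using Finset.induction_on with
  | empty => rw [image_empty, union_empty, numRegions_succPairs, sum_empty, add_zero]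
  | insert i J hi ih =>
    have hnew : (0, i.succ) ∉ succPairs m ∪ J.image fun j : Fin m ↦ (0, j.succ) := by
      simpa [zero_notMem_succPairs] using hi
    have hcollapse : numRegions coordDiff (W ⊓ LinearMap.ker (coordDiff (0, i.succ)))
        (succPairs m ∪ J.image fun j : Fin m ↦ (0, j.succ)) = chamberCount (collapse W i) := by
      rw [numRegions_union_of_eq_mul, numRegions_succPairs, collapse]
      intro p hp _
      obtain ⟨j, hj, rfl⟩ := mem_image.1 hp
      have hij : i ≠ j := (ne_of_mem_of_not_mem hj hi).symm
      obtain ⟨q, hq, c, hc, h⟩ := exists_succPairs_coordDiff_eq_mul hij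
      exact ⟨q, hq, c, hc, fun w hw ↦ h w hw.2⟩
    rw [image_insert, union_insert, numRegions_insert hnew (hW i (mem_insert_self i J)),
      ih fun j hj ↦ hW j (mem_insert_of_mem hj), hcollapse, sum_insert hi, add_assoc,
      add_comm (chamberCount (collapse W i))]

lemma chamberCount_succ {W : Submodule ℝ (Fin (m + 1) → ℝ)}
    (hW : ∀ i : Fin m, ∃ w ∈ W, coordDiff (0, i.succ) w ≠ 0) :
    chamberCount W = chamberCount (W.map (tail m)) + ∑ i, chamberCount (collapse W i) := by
  rw [chamberCount_eq_numRegions, orderedPairs_succ,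
    numRegions_succPairs_union _ fun i _ ↦ hW i]

lemma chamberCount_top : chamberCount (⊤ : Submodule ℝ (Fin m → ℝ)) = m.factorial := by
  classical
  have hσ (σ : Equiv.Perm (Fin m)) :
      ∃ w ∈ (⊤ : Submodule ℝ (Fin m → ℝ)), StrictAnti (w ∘ σ) :=
    ⟨fun i ↦ -(σ.symm i : ℝ), mem_top, fun i j hij ↦ by simpa using hij⟩
  rw [chamberCount, filter_true_of_mem fun σ _ ↦ hσ σ, card_univ, Fintype.card_perm,
    Fintype.card_fin]

lemma IsGeneric.chamberCount_eq_zero {W : Submodule ℝ (Fin m → ℝ)} (hW : IsGeneric d W)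
    (hm : 2 ≤ m) (hd : m ≤ d + 1) : chamberCount W = 0 := by
  classical
  refine card_eq_zero.2 (filter_eq_empty_iff.2 ?_)
  rintro σ - ⟨w, hw, hσ⟩
  have hvalues : (Set.range w).ncard ≤ d + 1 := by
    rw [← Nat.card_coe_set_eq]
    exact (Finite.card_range_le w).trans (by rwa [Nat.card_fin])
  have hlt := hσ (show (⟨0, by lia⟩ : Fin m) < ⟨1, by lia⟩ from Nat.zero_lt_one)
  exact hlt.ne (hW w hw hvalues _ _)

theorem IsGeneric.chamberCount_add {W : Submodule ℝ (Fin m → ℝ)} (hW : IsGeneric d W)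
    (hm : 2 ≤ m) (hd : m ≤ finrank ℝ W + d) :
    chamberCount W + 2 * stirlingSum m d = m.factorial := by
  induction m generalizing d with
  | zero => lia
  | succ m ih =>
    rcases Nat.eq_zero_or_pos d with rfl | hdpos
    · have htop : W = ⊤ := by
        refine eq_top_of_finrank_eq (le_antisymm W.finrank_le ?_)
        simpa using hd
      rw [htop, chamberCount_top, stirlingSum_zero, mul_zero, add_zero]
    rcases Nat.lt_or_ge m (d + 1) with hmd | hmd
    · rw [hW.chamberCount_eq_zero hm hmd, two_mul_stirlingSum_eq_factorial hm hmd, zero_add]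
    obtain ⟨d, rfl⟩ := Nat.exists_eq_add_of_le' hdpos
    obtain ⟨m, rfl⟩ := Nat.exists_eq_add_of_le' (show 1 ≤ m by lia)
    have hdelete := ih hW.map_tail (by lia) (by rw [hW.finrank_map_tail (by lia)]; lia)
    have hcollapse (i : Fin (m + 1)) := ih (hW.collapse i) (by lia)
      (by have := finrank_le_finrank_collapse_add_one W i; lia)
    have hsum := sum_congr rfl fun i (_ : i ∈ univ) ↦ hcollapse i
    simp only [sum_add_distrib, sum_const, card_univ, Fintype.card_fin, smul_eq_mul] at hsum
    rw [chamberCount_succ (hW.exists_coordDiff_ne_zero (by lia) hd), stirlingSum_succ_succ,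
      Nat.factorial_succ (m + 1)]
    linarith

end Chambers

section Walks

open Module

lemma apply_eq_of_castSucc_eq_succ {α : Type*} {n : ℕ} {u : Fin (n + 1) → α}
    (hu : ∀ q : Fin n, u q.castSucc = u q.succ) (i j : Fin (n + 1)) : u i = u j := by
  have hconst (p : Fin (n + 1)) : u p = u 0 := by
    induction p using Fin.induction with
    | zero => rfl
    | succ q ih => rw [← hu, ih]
  rw [hconst, hconst j]

variable {ι κ E : Type*} [AddCommGroup E]

/-- The sum of the first `i` terms of `x`. -/
def prefixSum {n : ℕ} (x : Fin n → E) (i : ℕ) : E := ∑ j with j.val < i, x j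

lemma prefixSum_of_le {n i : ℕ} (x : Fin n → E) (hi : n ≤ i) : prefixSum x i = ∑ j, x j := by
  rw [prefixSum, filter_true_of_mem fun j _ ↦ j.isLt.trans_le hi]

lemma prefixSum_add_one {n : ℕ} (x : Fin n → E) (i : Fin n) :
    prefixSum x (i + 1) = prefixSum x i + x i := by
  have hinsert : ({j | j.val < i + 1} : Finset (Fin n)) =
      insert i ({j | j.val < i} : Finset (Fin n)) := by
    ext j
    simp only [mem_filter_univ, mem_insert, Fin.ext_iff]
    lia
  rw [prefixSum, hinsert, sum_insert (by simp), add_comm, prefixSum]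

lemma prefixSum_castSucc {n i : ℕ} (x : Fin (n + 1) → E) (hi : i ≤ n) :
    prefixSum (fun j : Fin n ↦ x j.castSucc) i = prefixSum x i := by
  simp [prefixSum, sum_filter, Fin.sum_univ_castSucc, hi]

section BlockSums

variable [Fintype ι] [DecidableEq κ]

/-- The sums of `x` over the fibres of `c`. -/
def blockSums (c : ι → κ) (x : ι → E) (q : κ) : E := ∑ i with c i = q, x i

lemma sum_blockSums [Fintype κ] (c : ι → κ) (x : ι → E) : ∑ q, blockSums c x q = ∑ i, x i :=
  sum_fiberwise univ c x

lemma blockSums_perm_comp (c : ι → κ) (σ : Equiv.Perm κ) (x : ι → E) :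
    blockSums (σ ∘ c) x = blockSums c x ∘ σ.symm := by
  ext q
  simp [blockSums, Equiv.eq_symm_apply]

lemma blockSums_comp_perm (c : ι → κ) (σ : Equiv.Perm ι) (x : ι → E) :
    blockSums (c ∘ σ) (x ∘ σ) = blockSums c x := by
  ext q
  simp only [blockSums, sum_filter, Function.comp_apply]
  exact Equiv.sum_comp σ fun i ↦ if c i = q then x i else 0

lemma blockSums_perm [DecidableEq ι] (σ : Equiv.Perm ι) (x : ι → E) :
    blockSums σ x = x ∘ σ.symm := by
  ext q
  simp [blockSums, ← Equiv.eq_symm_apply, filter_eq']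

end BlockSums

variable [Module ℝ E]

/-- The coefficient vectors of the linear relations between the vectors `x i`. -/
def relations [Fintype ι] (x : ι → E) : Submodule ℝ (ι → ℝ) :=
  LinearMap.ker (Fintype.linearCombination ℝ x)

lemma mem_relations [Fintype ι] {x : ι → E} {w : ι → ℝ} :
    w ∈ relations x ↔ ∑ i, w i • x i = 0 := by
  rw [relations, LinearMap.mem_ker, Fintype.linearCombination_apply]

lemma card_le_finrank_relations_add [Fintype ι] [FiniteDimensional ℝ E] (x : ι → E) :
    Fintype.card ι ≤ finrank ℝ (relations x) + finrank ℝ E := by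
  have hrank := (Fintype.linearCombination ℝ x).finrank_range_add_finrank_ker
  have hrange := (LinearMap.range (Fintype.linearCombination ℝ x)).finrank_le
  rw [finrank_fintype_fun_eq_card] at hrank
  rw [relations]
  lia

lemma relations_blockSums [Fintype ι] [Fintype κ] [DecidableEq κ] (c : ι → κ) (x : ι → E) :
    relations (blockSums c x) = (relations x).comap (LinearMap.funLeft ℝ ℝ c) := by
  ext w
  have hsum : ∑ q, w q • blockSums c x q = ∑ i, w (c i) • x i := by
    simp only [blockSums, smul_sum]
    rw [← sum_fiberwise univ c]
    refine sum_congr rfl fun q _ ↦ sum_congr rfl fun i hi ↦ ?_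
    rw [(mem_filter.1 hi).2]
  simp only [mem_relations, Submodule.mem_comap, LinearMap.funLeft_apply, hsum]

lemma IsGeneric.relations_blockSums [Fintype ι] [Fintype κ] [DecidableEq κ] {d : ℕ} {x : ι → E}
    (hx : IsGeneric d (relations x)) {c : ι → κ} (hc : Function.Surjective c) :
    IsGeneric d (relations (blockSums c x)) := by
  rw [RandomBridge.relations_blockSums]
  exact hx.comap_funLeft hc

lemma mem_relations_comp_perm [Fintype ι] {x : ι → E} {σ : Equiv.Perm ι} {u : ι → ℝ} :
    u ∈ relations (x ∘ σ) ↔ u ∘ σ.symm ∈ relations x := by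
  classical
  rw [← Equiv.symm_symm σ, ← blockSums_perm, relations_blockSums]
  rfl

lemma sum_smul_eq_add_sum_smul_prefixSum {k : ℕ} (t : Fin (k + 1) → ℝ) (y : Fin (k + 1) → E) :
    ∑ p, t p • y p = t (Fin.last k) • ∑ p, y p +
      ∑ q : Fin k, (t q.castSucc - t q.succ) • prefixSum y (q + 1) := by
  induction k with
  | zero => simp
  | succ k ih =>
    have hprefix (q : Fin k) :
        prefixSum (fun j ↦ y (Fin.castSucc j)) (q + 1) = prefixSum y (q + 1) :=
      prefixSum_castSucc y (by lia)
    have hlast : prefixSum y (k + 1) = ∑ p : Fin (k + 1), y p.castSucc := by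
      rw [← prefixSum_castSucc y le_rfl, prefixSum_of_le _ le_rfl]
    have hsplit := Fin.sum_univ_castSucc fun q : Fin (k + 1) ↦
      (t q.castSucc - t q.succ) • prefixSum y (q + 1)
    rw [hsplit, Fin.sum_univ_castSucc, ih (fun p ↦ t p.castSucc), Fin.sum_univ_castSucc y]
    simp only [hprefix, hlast, Fin.val_castSucc, Fin.val_last, Fin.succ_last, Fin.succ_castSucc]
    module

section Hull

lemma convexHull_range_eq_image_stdSimplex [Fintype ι] (v : ι → E) :
    convexHull ℝ (Set.range v) = Fintype.linearCombination ℝ v '' stdSimplex ℝ ι := by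
  classical
  rw [← convexHull_rangle_single_eq_stdSimplex, LinearMap.image_convexHull, ← Set.range_comp]
  refine congrArg (fun f ↦ convexHull ℝ (Set.range f)) (funext fun i ↦ ?_)
  rw [Function.comp_apply, Fintype.linearCombination_apply_single, one_smul]

lemma zero_mem_convexHull_range_iff [Fintype ι] {v : ι → E} :
    0 ∈ convexHull ℝ (Set.range v) ↔ ∃ a ∈ relations v, 0 < a := by
  rw [convexHull_range_eq_image_stdSimplex]
  constructor
  · rintro ⟨a, ⟨ha_nonneg, ha_sum⟩, hav⟩
    refine ⟨a, hav, lt_of_le_of_ne ha_nonneg ?_⟩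
    rintro rfl
    simp at ha_sum
  · rintro ⟨a, hav, ha⟩
    have hsum : 0 < ∑ i, a i := Fintype.sum_pos ha
    refine ⟨(∑ i, a i)⁻¹ • a, ⟨fun i ↦ ?_, ?_⟩, (relations v).smul_mem _ hav⟩
    · exact mul_nonneg (inv_nonneg.2 hsum.le) (ha.le i)
    · simp only [Pi.smul_apply, smul_eq_mul, ← mul_sum]
      exact inv_mul_cancel₀ hsum.ne'

variable {k : ℕ} {y : Fin (k + 1) → E}

/-- The convex hull of the proper prefix sums of a walk, both endpoints excluded. -/
def walkHull (y : Fin (k + 1) → E) : Set E :=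
  convexHull ℝ (Set.range fun q : Fin k ↦ prefixSum y (q + 1))

lemma mem_relations_prefixSum_iff (hy : ∑ p, y p = 0) {u : Fin (k + 1) → ℝ} :
    (fun q : Fin k ↦ u q.castSucc - u q.succ) ∈ relations (fun q : Fin k ↦ prefixSum y (q + 1)) ↔
      u ∈ relations y := by
  rw [mem_relations, mem_relations, sum_smul_eq_add_sum_smul_prefixSum, hy, smul_zero, zero_add]

lemma zero_mem_walkHull_iff (hy : ∑ p, y p = 0) :
    0 ∈ walkHull y ↔ ∃ u ∈ relations y, Antitone u ∧ ∃ i j, u i ≠ u j := by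
  rw [walkHull, zero_mem_convexHull_range_iff]
  constructor
  · rintro ⟨a, ha, ha_pos⟩
    have hstep (q : Fin k) : -prefixSum a q - -prefixSum a (q + 1) = a q := by
      rw [prefixSum_add_one]
      abel
    refine ⟨fun p ↦ -prefixSum a p, ?_, Fin.antitone_iff_succ_le.2 fun q ↦ ?_, ?_⟩
    · simpa only [← mem_relations_prefixSum_iff hy, Fin.val_castSucc, Fin.val_succ, hstep]
    · have := ha_pos.le q
      rw [← hstep q] at this
      simpa using this
    · obtain ⟨-, q, hq⟩ := Pi.lt_def.1 ha_pos
      refine ⟨q.castSucc, q.succ, sub_ne_zero.1 ?_⟩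
      simpa only [Fin.val_castSucc, Fin.val_succ, hstep] using (ne_of_gt hq : a q ≠ 0)
  · rintro ⟨u, hu, hanti, i, j, hij⟩
    refine ⟨_, (mem_relations_prefixSum_iff hy).2 hu, Pi.lt_def.2 ⟨fun q ↦ ?_, ?_⟩⟩
    · exact sub_nonneg.2 (hanti q.castSucc_lt_succ.le)
    · by_contra! hle
      refine hij (apply_eq_of_castSucc_eq_succ (fun q ↦ ?_) i j)
      exact le_antisymm (sub_nonpos.1 (hle q)) (hanti q.castSucc_lt_succ.le)

variable [FiniteDimensional ℝ E]

lemma IsGeneric.zero_mem_walkHull_iff (hgen : IsGeneric (finrank ℝ E) (relations y))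
    (hk : 1 ≤ k) (hy : ∑ p, y p = 0) :
    0 ∈ walkHull y ↔ ∃ u ∈ relations y, StrictAnti u := by
  rw [RandomBridge.zero_mem_walkHull_iff hy]
  constructor
  · rintro ⟨u, hu, hanti, hne⟩
    have hdim := card_le_finrank_relations_add y
    rw [Fintype.card_fin] at hdim
    exact hgen.exists_strictAnti hdim hu hanti hne
  · rintro ⟨u, hu, hanti⟩
    have hne : (0 : Fin (k + 1)) ≠ Fin.last k := by
      simp only [ne_eq, Fin.ext_iff, Fin.val_zero, Fin.val_last]
      lia
    exact ⟨u, hu, hanti.antitone, 0, Fin.last k, hanti.injective.ne hne⟩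

open Classical in
theorem IsGeneric.card_perm_zero_notMem_walkHull (hgen : IsGeneric (finrank ℝ E) (relations y))
    (hk : 1 ≤ k) (hy : ∑ p, y p = 0) :
    #{σ : Equiv.Perm (Fin (k + 1)) | 0 ∉ walkHull (y ∘ σ)} =
      2 * stirlingSum (k + 1) (finrank ℝ E) := by
  have hchamber : #{σ : Equiv.Perm (Fin (k + 1)) | 0 ∈ walkHull (y ∘ σ)} =
      chamberCount (relations y) := by
    refine congrArg card (filter_congr fun σ _ ↦ ?_)
    have hgenσ : IsGeneric (finrank ℝ E) (relations (y ∘ σ)) := by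
      rw [← Equiv.symm_symm σ, ← blockSums_perm]
      exact hgen.relations_blockSums σ.symm.surjective
    rw [hgenσ.zero_mem_walkHull_iff hk (by rwa [← Equiv.sum_comp σ] at hy)]
    constructor
    · rintro ⟨u, hu, hanti⟩
      exact ⟨u ∘ σ.symm, mem_relations_comp_perm.1 hu, by simpa [Function.comp_assoc] using hanti⟩
    · rintro ⟨w, hw, hanti⟩
      exact ⟨w ∘ σ, mem_relations_comp_perm.2 (by simpa [Function.comp_assoc] using hw), hanti⟩
  have hcount := hgen.chamberCount_add (by lia)
    (by simpa using card_le_finrank_relations_add y)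
  have hcompl := card_filter_add_card_filter_not (s := univ)
    fun σ : Equiv.Perm (Fin (k + 1)) ↦ 0 ∈ walkHull (y ∘ σ)
  rw [hchamber, card_univ, Fintype.card_perm, Fintype.card_fin] at hcompl
  lia

open Classical in
lemma IsGeneric.card_perm_zero_notMem_walkHull_blockSums {d n : ℕ} {x : Fin (n + 1) → E}
    (hgen : IsGeneric d (relations x)) (hd : finrank ℝ E = d) (hk : 1 ≤ k) (hx : ∑ i, x i = 0)
    {b : Fin (n + 1) → Fin (k + 1)} (hb : Function.Surjective b) :
    #{σ : Equiv.Perm (Fin (k + 1)) | 0 ∉ walkHull (blockSums (σ ∘ b) x)} =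
      2 * stirlingSum (k + 1) d := by
  subst hd
  rw [← (hgen.relations_blockSums hb).card_perm_zero_notMem_walkHull hk
    ((sum_blockSums b x).trans hx)]
  refine card_equiv (Equiv.inv _) fun σ ↦ ?_
  rw [mem_filter_univ, mem_filter_univ, blockSums_perm_comp]
  rfl

end Hull

end Walks

section CutPoints

variable {E : Type*} [AddCommGroup E] {n k : ℕ} {b : Fin (n + 1) → Fin (k + 1)}

lemma lt_card_filter_lt_iff {α : Type*} [LinearOrder α] {m : ℕ} {f : Fin m → α} (hf : Monotone f)
    {j : Fin m} {a : α} : j < #{i | f i < a} ↔ f j < a := by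
  constructor
  · contrapose!
    intro hj
    refine (card_le_card (t := Iio j) fun i hi ↦ mem_Iio.2 ?_).trans_eq (Fin.card_Iio j)
    exact hf.reflect_lt (((mem_filter_univ i).1 hi).trans_le hj)
  · intro hj
    rw [← Nat.add_one_le_iff, ← Fin.card_Iic]
    exact card_le_card fun i hi ↦ (mem_filter_univ i).2 ((hf (mem_Iic.1 hi)).trans_lt hj)

/-- The monotone surjections from `n + 1` letters onto `k + 1` consecutive blocks. -/
def monoSurj (n k : ℕ) : Finset (Fin (n + 1) → Fin (k + 1)) :=
  open Classical in {b | Monotone b ∧ Function.Surjective b}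

lemma mem_monoSurj : b ∈ monoSurj n k ↔ Monotone b ∧ Function.Surjective b := by
  simp [monoSurj]

/-- The number of letters that `b` sends to one of the blocks `0, …, q`; for monotone `b`, the
place where block `q + 1` starts. -/
def cutPoint (b : Fin (n + 1) → Fin (k + 1)) (q : Fin k) : ℕ := #{j | b j < q.succ}

/-- The set of places where a block of `b` other than block `0` starts. -/
def cutSet (b : Fin (n + 1) → Fin (k + 1)) : Finset ℕ := univ.image (cutPoint b)

lemma lt_cutPoint_iff (hb : Monotone b) {j : Fin (n + 1)} {q : Fin k} :
    j < cutPoint b q ↔ b j < q.succ :=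
  lt_card_filter_lt_iff hb

lemma cutPoint_mem_Icc (hb : b ∈ monoSurj n k) (q : Fin k) : cutPoint b q ∈ Icc 1 n := by
  obtain ⟨hmono, hsurj⟩ := mem_monoSurj.1 hb
  obtain ⟨i, hi⟩ := hsurj 0
  obtain ⟨j, hj⟩ := hsurj (Fin.last k)
  have hfirst : i < cutPoint b q := (lt_cutPoint_iff hmono).2 (hi ▸ q.succ_pos)
  have hlast : ¬ j < cutPoint b q := by
    rw [lt_cutPoint_iff hmono, hj, not_lt]
    exact Fin.le_last _
  rw [mem_Icc]
  lia

lemma strictMono_cutPoint (hb : b ∈ monoSurj n k) : StrictMono (cutPoint b) := by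
  obtain ⟨hmono, hsurj⟩ := mem_monoSurj.1 hb
  intro p q hpq
  obtain ⟨j, hj⟩ := hsurj p.succ
  have hp : ¬ j < cutPoint b p := by rw [lt_cutPoint_iff hmono, hj]; exact lt_irrefl _
  exact (not_lt.1 hp).trans_lt ((lt_cutPoint_iff hmono).2 (hj ▸ Fin.succ_lt_succ_iff.2 hpq))

lemma cutSet_mem_powersetCard (hb : b ∈ monoSurj n k) : cutSet b ∈ (Icc 1 n).powersetCard k := by
  refine mem_powersetCard.2 ⟨image_subset_iff.2 fun q _ ↦ cutPoint_mem_Icc hb q, ?_⟩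
  rw [cutSet, card_image_of_injective _ (strictMono_cutPoint hb).injective, card_univ,
    Fintype.card_fin]

lemma injOn_cutSet : Set.InjOn (cutSet (n := n) (k := k)) (monoSurj n k) := by
  intro b hb b' hb' hcut
  have hrange : Set.range (cutPoint b) = Set.range (cutPoint b') := by
    simpa [cutSet] using congrArg (fun I : Finset ℕ ↦ (I : Set ℕ)) hcut
  rw [(strictMono_cutPoint hb).range_inj (strictMono_cutPoint hb')] at hrange
  have hlt (j : Fin (n + 1)) (q : Fin k) : b j < q.succ ↔ b' j < q.succ := by
    rw [← lt_cutPoint_iff (mem_monoSurj.1 hb).1, ← lt_cutPoint_iff (mem_monoSurj.1 hb').1, hrange]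
  refine funext fun j ↦ eq_of_forall_gt_iff fun p ↦ ?_
  induction p using Fin.cases with
  | zero => simp
  | succ q => exact hlt j q

lemma exists_cutSet_eq {I : Finset ℕ} (hI : I ∈ (Icc 1 n).powersetCard k) :
    ∃ b ∈ monoSurj n k, cutSet b = I := by
  obtain ⟨hsub, hcard⟩ := mem_powersetCard.1 hI
  set e := I.orderEmbOfFin hcard
  have he (q : Fin k) : 1 ≤ e q ∧ e q ≤ n := mem_Icc.1 (hsub (I.orderEmbOfFin_mem hcard q))
  let b (j : Fin (n + 1)) : Fin (k + 1) := ⟨#{q | e q < j.val + 1},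
    Nat.lt_succ_of_le ((card_le_univ _).trans_eq (Fintype.card_fin k))⟩
  have hb (j : Fin (n + 1)) (q : Fin k) : b j < q.succ ↔ j < e q := by
    have := lt_card_filter_lt_iff e.monotone (j := q) (a := j.val + 1)
    simp only [b, Fin.lt_def, Fin.val_succ]
    lia
  have hcut : cutPoint b = e := by
    ext q
    simp only [cutPoint, hb, Fin.card_filter_val_lt]
    exact min_eq_right ((he q).2.trans n.le_succ)
  have hmono : Monotone b := by
    refine fun i j hij ↦ Fin.mk_le_mk.2 (card_le_card ?_)
    exact monotone_filter_right univ fun q _ hq ↦ hq.trans_le (Nat.succ_le_succ hij)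
  have hsurj : Function.Surjective b := by
    intro p
    induction p using Fin.cases with
    | zero => exact ⟨0, by simp [b, fun q ↦ Nat.ne_of_gt (he q).1]⟩
    | succ q =>
      refine ⟨⟨e q, Nat.lt_succ_of_le (he q).2⟩, Fin.ext ?_⟩
      simp only [b, Nat.lt_succ_iff, e.le_iff_le, Fin.val_succ]
      simp [filter_ge_eq_Iic]
  refine ⟨b, mem_monoSurj.2 ⟨hmono, hsurj⟩, ?_⟩
  rw [cutSet, hcut, I.image_orderEmbOfFin_univ hcard]

lemma sum_monoSurj {M : Type*} [AddCommMonoid M] (g : Finset ℕ → M) :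
    ∑ b ∈ monoSurj n k, g (cutSet b) = ∑ I ∈ (Icc 1 n).powersetCard k, g I :=
  sum_nbij cutSet (fun _ ↦ cutSet_mem_powersetCard) injOn_cutSet (fun _ ↦ exists_cutSet_eq)
    fun _ _ ↦ rfl

lemma card_monoSurj (n k : ℕ) : #(monoSurj n k) = n.choose k := by
  rw [card_eq_sum_ones, sum_monoSurj fun _ ↦ 1, ← card_eq_sum_ones, card_powersetCard,
    Nat.card_Icc, Nat.add_sub_cancel]

lemma prefixSum_blockSums (hb : Monotone b) (x : Fin (n + 1) → E) (q : Fin k) :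
    prefixSum (blockSums b x) (q + 1) = prefixSum x (cutPoint b q) := by
  have hmaps (i : Fin (n + 1)) (hi : i ∈ ({i | b i < q.succ} : Finset _)) :
      b i ∈ ({p | p.val < q.val + 1} : Finset (Fin (k + 1))) := by
    simpa [Fin.lt_def] using hi
  simp only [prefixSum, lt_cutPoint_iff hb]
  rw [← sum_fiberwise_of_maps_to hmaps]
  refine sum_congr rfl fun p hp ↦ sum_congr (ext fun i ↦ ?_) fun _ _ ↦ rfl
  have hp' : p < q.succ := by simpa [Fin.lt_def] using hp
  simpa using fun h : b i = p ↦ h ▸ hp'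

lemma walkHull_blockSums [Module ℝ E] (hb : Monotone b) (x : Fin (n + 1) → E) :
    walkHull (blockSums b x) = convexHull ℝ (prefixSum x '' cutSet b) := by
  simp only [walkHull, prefixSum_blockSums hb, cutSet, coe_image, coe_univ, Set.image_univ]
  rw [← Set.range_comp]
  rfl

lemma comp_sort_mem_monoSurj {c : Fin (n + 1) → Fin (k + 1)} (hc : Function.Surjective c) :
    c ∘ Tuple.sort c ∈ monoSurj n k :=
  mem_monoSurj.2 ⟨Tuple.monotone_sort c, hc.comp (Tuple.sort c).surjective⟩

lemma comp_perm_eq_of_mem_monoSurj {π : Equiv.Perm (Fin (n + 1))} (hb : b ∈ monoSurj n k)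
    (hbπ : b ∘ π ∈ monoSurj n k) : b ∘ π = b :=
  Tuple.unique_monotone (f := b) (σ := π) (τ := Equiv.refl _) (mem_monoSurj.1 hbπ).1
    (mem_monoSurj.1 hb).1

lemma sum_monoSurj_perm_comp {M : Type*} [AddCommMonoid M]
    {g : (Fin (n + 1) → Fin (k + 1)) → M}
    (hg : ∀ c (π : Equiv.Perm (Fin (n + 1))), g (c ∘ π) = g c) (σ : Equiv.Perm (Fin (k + 1))) :
    ∑ b ∈ monoSurj n k, g (σ ∘ b) = ∑ b ∈ monoSurj n k, g b := by
  set f : (Fin (n + 1) → Fin (k + 1)) → (Fin (n + 1) → Fin (k + 1)) :=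
    fun b ↦ (σ ∘ b) ∘ Tuple.sort (σ ∘ b)
  have hmaps : Set.MapsTo f (monoSurj n k) (monoSurj n k) := fun b hb ↦
    comp_sort_mem_monoSurj (σ.surjective.comp (mem_monoSurj.1 hb).2)
  have hinj : Set.InjOn f (monoSurj n k) := by
    intro b hb b' hb' hbb'
    set π := (Tuple.sort (σ ∘ b)).symm.trans (Tuple.sort (σ ∘ b'))
    have hπ : b' ∘ π = b := by
      funext j
      have := congrFun hbb' ((Tuple.sort (σ ∘ b)).symm j)
      simp only [f, Function.comp_apply, Equiv.apply_symm_apply, EmbeddingLike.apply_eq_iff_eq]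
        at this
      exact this.symm
    rw [← hπ]
    exact comp_perm_eq_of_mem_monoSurj hb' (by rwa [hπ])
  exact sum_nbij f hmaps hinj (surjOn_of_injOn_of_card_le f hmaps hinj le_rfl) fun b _ ↦
    (hg _ _).symm

end CutPoints

section GeneralPosition

variable {E : Type*} [AddCommGroup E] [Module ℝ E] {d n : ℕ}

lemma card_filter_ne_succ_lt_ncard_range {u : Fin (n + 1) → ℝ} (hu : Monotone u) :
    #{q : Fin n | u q.castSucc ≠ u q.succ} < (Set.range u).ncard := by
  set D : Finset (Fin n) := {q | u q.castSucc ≠ u q.succ}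
  have hlt {q : Fin n} (hq : q ∈ D) : u q.castSucc < u q.succ :=
    (hu q.castSucc_lt_succ.le).lt_of_ne ((mem_filter_univ q).1 hq)
  have hmono : StrictMonoOn (fun q : Fin n ↦ u q.succ) D := fun p _ q hq hpq ↦
    (hu (Fin.succ_le_castSucc_iff.2 hpq)).trans_lt (hlt hq)
  have hzero : u 0 ∉ D.image fun q ↦ u q.succ := by
    simp only [mem_image, not_exists, not_and]
    exact fun q hq ↦ ((hu (Fin.zero_le _)).trans_lt (hlt hq)).ne'
  calc #D < #(insert (u 0) (D.image fun q ↦ u q.succ)) := by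
        rw [card_insert_of_notMem hzero, card_image_of_injOn hmono.injOn]
        exact Nat.lt_succ_self _
    _ ≤ (Set.range u).ncard := by
        rw [← Set.ncard_coe_finset]
        refine Set.ncard_le_ncard ?_
        simp [Set.subset_def]

lemma linearIndepOn_of_forall_powersetCard {v : ℕ → E} {m : ℕ} (hm : m ≤ n)
    (hv : ∀ I ∈ (Icc 1 n).powersetCard m, LinearIndependent ℝ fun i : I ↦ v i)
    {D : Finset (Fin n)} (hD : #D ≤ m) : LinearIndepOn ℝ (fun q : Fin n ↦ v (q + 1)) D := by
  obtain ⟨I, hDI, hIn, hI⟩ : ∃ I, D.image (fun q ↦ q.val + 1) ⊆ I ∧ I ⊆ Icc 1 n ∧ #I = m := by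
    refine exists_subsuperset_card_eq (image_subset_iff.2 fun q _ ↦ ?_)
      (card_image_le.trans hD) (by simpa using hm)
    rw [mem_Icc]
    lia
  have hind : LinearIndepOn ℝ v I := hv I (mem_powersetCard.2 ⟨hIn, hI⟩)
  refine (hind.mono ?_).comp_of_image fun p _ q _ hpq ↦ Fin.ext (Nat.succ_injective hpq)
  rw [← coe_image]
  exact coe_subset.2 hDI

lemma apply_eq_of_mem_relations {y : Fin (n + 1) → E} (hy : ∑ i, y i = 0)
    (hind : ∀ I ∈ (Icc 1 n).powersetCard (min d n), LinearIndependent ℝ fun i : I ↦ prefixSum y i)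
    {u : Fin (n + 1) → ℝ} (hrel : u ∈ relations y) (hu : Monotone u)
    (hcard : (Set.range u).ncard ≤ d + 1) : ∀ i j, u i = u j := by
  set D : Finset (Fin n) := {q | u q.castSucc ≠ u q.succ}
  have hD : #D ≤ min d n := by
    refine le_min ?_ (D.card_le_univ.trans_eq (Fintype.card_fin n))
    have := card_filter_ne_succ_lt_ncard_range hu
    lia
  have hsum : ∑ q ∈ D, (u q.castSucc - u q.succ) • prefixSum y (q + 1) = 0 := by
    rw [← mem_relations.1 ((mem_relations_prefixSum_iff hy).2 hrel)]
    refine sum_subset D.subset_univ fun q _ hq ↦ ?_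
    rw [sub_eq_zero.2 (by simpa [D] using hq), zero_smul]
  have hzero := linearIndepOn_finset_iff.1
    (linearIndepOn_of_forall_powersetCard (min_le_right _ _) hind hD) _ hsum
  refine apply_eq_of_castSucc_eq_succ fun q ↦ ?_
  by_contra hq
  exact sub_ne_zero.2 hq (hzero q (by simpa [D] using hq))

lemma isGeneric_relations {x : Fin (n + 1) → E} (hx : ∑ i, x i = 0)
    (hind : ∀ σ : Equiv.Perm (Fin (n + 1)), ∀ I ∈ (Icc 1 n).powersetCard (min d n),
      LinearIndependent ℝ fun i : I ↦ prefixSum (x ∘ σ) i) :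
    IsGeneric d (relations x) := by
  intro w hw hcard i j
  set σ := Tuple.sort w
  have hrel : w ∘ σ ∈ relations (x ∘ σ) :=
    mem_relations_comp_perm.2 (by simpa [Function.comp_assoc] using hw)
  rw [← σ.surjective.range_comp w] at hcard
  simpa using apply_eq_of_mem_relations (by rwa [← Equiv.sum_comp σ] at hx) (hind σ) hrel
    (Tuple.monotone_sort w) hcard (σ.symm i) (σ.symm j)

end GeneralPosition

section Measurability

lemma isClosed_zero_mem_convexHull_range {ι E : Type*} [Finite ι] [NormedAddCommGroup E]
    [NormedSpace ℝ E] : IsClosed {v : ι → E | 0 ∈ convexHull ℝ (Set.range v)} := by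
  have := Fintype.ofFinite ι
  have : CompactSpace (stdSimplex ℝ ι) := isCompact_iff_compactSpace.1 (isCompact_stdSimplex ℝ ι)
  have hcont : Continuous fun p : stdSimplex ℝ ι × (ι → E) ↦ ∑ i, p.1.1 i • p.2 i :=
    continuous_finsetSum _ fun i _ ↦
      ((continuous_apply i).comp (continuous_subtype_val.comp continuous_fst)).smul
        ((continuous_apply i).comp continuous_snd)
  have hclosed : IsClosed {p : stdSimplex ℝ ι × (ι → E) | ∑ i, p.1.1 i • p.2 i = 0} :=
    isClosed_eq hcont continuous_const
  convert isClosedMap_snd_of_compactSpace _ hclosed using 1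
  ext v
  simp [convexHull_range_eq_image_stdSimplex, Fintype.linearCombination_apply]

lemma continuous_prefixSum {E : Type*} [AddCommGroup E] [TopologicalSpace E]
    [IsTopologicalAddGroup E] {n : ℕ} (i : ℕ) :
    Continuous fun x : Fin n → E ↦ prefixSum x i :=
  continuous_finsetSum _ fun j _ ↦ continuous_apply j

variable {d n k : ℕ}

lemma measurableSet_zero_notMem_walkHull (c : Fin (n + 1) → Fin (k + 1)) :
    MeasurableSet {x : Fin (n + 1) → EuclideanSpace ℝ (Fin d) | 0 ∉ walkHull (blockSums c x)} := by
  have hcont : Continuous fun (x : Fin (n + 1) → EuclideanSpace ℝ (Fin d)) (q : Fin k) ↦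
      prefixSum (blockSums c x) (q + 1) :=
    continuous_pi fun q ↦ (continuous_prefixSum _).comp <|
      continuous_pi fun p ↦ continuous_finsetSum _ fun i _ ↦ continuous_apply i
  exact (isClosed_zero_mem_convexHull_range.preimage hcont).measurableSet.compl

lemma integral_card_filter_mem {Ω ι : Type*} [MeasurableSpace Ω] {P : Measure Ω}
    [IsFiniteMeasure P] {s : Finset ι} {A : ι → Set Ω} [∀ i, DecidablePred (· ∈ A i)]
    (hA : ∀ i, NullMeasurableSet (A i) P) :
    ∫ ω, (#{i ∈ s | ω ∈ A i} : ℝ) ∂P = ∑ i ∈ s, P.real (A i) := by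
  have hcard (ω : Ω) : (#{i ∈ s | ω ∈ A i} : ℝ) = ∑ i ∈ s, (A i).indicator 1 ω := by
    simp [Set.indicator_apply]
  have hint (i : ι) : Integrable ((A i).indicator (1 : Ω → ℝ)) P :=
    (integrable_const (1 : ℝ)).indicator₀ (hA i)
  simp only [hcard]
  rw [integral_finsetSum _ fun i _ ↦ hint i]
  refine sum_congr rfl fun i _ ↦ ?_
  rw [integral_indicator₀ (hA i)]
  simp

lemma sum_measureReal_eq_of_ae_card_eq {Ω ι : Type*} [MeasurableSpace Ω] {P : Measure Ω}
    [IsProbabilityMeasure P] {s : Finset ι} {A : ι → Set Ω} [∀ i, DecidablePred (· ∈ A i)] {N : ℕ}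
    (hA : ∀ i, NullMeasurableSet (A i) P) (hN : ∀ᵐ ω ∂P, #{i ∈ s | ω ∈ A i} = N) :
    ∑ i ∈ s, P.real (A i) = N := by
  rw [← integral_card_filter_mem hA, integral_congr_ae (hN.mono fun ω hω ↦ congrArg Nat.cast hω)]
  simp

end Measurability

section Expectation

variable {Ω : Type*} [MeasurableSpace Ω] {P : Measure Ω} {d n k : ℕ}
  {ξ : Fin (n + 1) → Ω → EuclideanSpace ℝ (Fin d)}

lemma IsExchangeable.nullMeasurableSet (hEx : IsExchangeable P ξ)
    {A : Set (Fin (n + 1) → EuclideanSpace ℝ (Fin d))} (hA : MeasurableSet A) :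
    NullMeasurableSet {ω | (fun i ↦ ξ i ω) ∈ A} P :=
  (hEx 1).aemeasurable_snd.nullMeasurableSet_preimage hA

lemma IsExchangeable.ae_linearIndependent_comp_perm {m : ℕ} (hEx : IsExchangeable P ξ)
    (hGP : InGeneralPosition P ξ m) :
    ∀ᵐ ω ∂P, ∀ σ : Equiv.Perm (Fin (n + 1)), ∀ I ∈ (Icc 1 n).powersetCard m,
      LinearIndependent ℝ fun i : I ↦ prefixSum ((fun j ↦ ξ j ω) ∘ σ) i := by
  refine ae_all_iff.2 fun σ ↦ (Filter.eventually_all_finset _).2 fun I hI ↦ ?_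
  have hopen : IsOpen {x : Fin (n + 1) → EuclideanSpace ℝ (Fin d) |
      LinearIndependent ℝ fun i : I ↦ prefixSum x i} :=
    isOpen_setOfPred_linearIndependent.preimage (continuous_pi fun i ↦ continuous_prefixSum _)
  exact (hEx σ).symm.ae_mem_snd hopen.measurableSet (ae_iff.2 (hGP I hI))

lemma IsBridge.ae_sum_eq_zero (hBr : IsBridge P ξ) : ∀ᵐ ω ∂P, ∑ i, ξ i ω = 0 :=
  hBr.mono fun _ hω ↦ (prefixSum_of_le _ le_rfl).symm.trans hω

lemma IsBridge.ae_isGeneric (hBr : IsBridge P ξ) (hEx : IsExchangeable P ξ)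
    (hGP : InGeneralPosition P ξ (min d n)) :
    ∀ᵐ ω ∂P, IsGeneric d (relations fun i ↦ ξ i ω) := by
  filter_upwards [hBr.ae_sum_eq_zero, hEx.ae_linearIndependent_comp_perm hGP] with ω hsum hind
  exact isGeneric_relations hsum hind

/-- The event that the walk whose increments are the sums of `ξ` over the blocks of `c` has a
hull missing the origin. -/
def avoidEvent (ξ : Fin (n + 1) → Ω → EuclideanSpace ℝ (Fin d))
    (c : Fin (n + 1) → Fin (k + 1)) : Set Ω :=
  {ω | 0 ∉ walkHull (blockSums c fun i ↦ ξ i ω)}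

lemma IsExchangeable.nullMeasurableSet_avoidEvent (hEx : IsExchangeable P ξ)
    (c : Fin (n + 1) → Fin (k + 1)) : NullMeasurableSet (avoidEvent ξ c) P :=
  hEx.nullMeasurableSet (measurableSet_zero_notMem_walkHull c)

lemma IsExchangeable.measureReal_avoidEvent_comp_perm (hEx : IsExchangeable P ξ)
    (c : Fin (n + 1) → Fin (k + 1)) (π : Equiv.Perm (Fin (n + 1))) :
    P.real (avoidEvent ξ (c ∘ π)) = P.real (avoidEvent ξ c) := by
  have hlaw := (hEx π).measure_mem_eq (measurableSet_zero_notMem_walkHull (d := d) (c ∘ π))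
  refine congrArg ENNReal.toReal (hlaw.symm.trans (congrArg P (Set.ext fun ω ↦ ?_)))
  have hperm := blockSums_comp_perm c π fun i ↦ ξ i ω
  simp only [avoidEvent, Set.mem_ofPred_eq, ← hperm]
  rfl

variable [IsProbabilityMeasure P]

lemma sum_perm_measureReal_avoidEvent (hBr : IsBridge P ξ) (hEx : IsExchangeable P ξ)
    (hGP : InGeneralPosition P ξ (min d n)) (hk : 1 ≤ k) {b : Fin (n + 1) → Fin (k + 1)}
    (hb : Function.Surjective b) :
    ∑ σ : Equiv.Perm (Fin (k + 1)), P.real (avoidEvent ξ (σ ∘ b)) =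
      2 * stirlingSum (k + 1) d := by
  classical
  have hcount : ∀ᵐ ω ∂P, #{σ : Equiv.Perm (Fin (k + 1)) | ω ∈ avoidEvent ξ (σ ∘ b)} =
      2 * stirlingSum (k + 1) d := by
    filter_upwards [hBr.ae_sum_eq_zero, hBr.ae_isGeneric hEx hGP] with ω hsum hgen
    rw [← hgen.card_perm_zero_notMem_walkHull_blockSums finrank_euclideanSpace_fin hk hsum hb]
    simp only [avoidEvent, Set.mem_ofPred_eq]
    congr
  exact_mod_cast sum_measureReal_eq_of_ae_card_eq
    (fun σ : Equiv.Perm (Fin (k + 1)) ↦ hEx.nullMeasurableSet_avoidEvent (σ ∘ b)) hcount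

lemma integral_halfCount_eq_sum_measureReal_avoidEvent (hEx : IsExchangeable P ξ) :
    ∫ ω, halfCount ξ k ω ∂P = 1 / 2 * ∑ b ∈ monoSurj n k, P.real (avoidEvent ξ b) := by
  classical
  have hcount (ω : Ω) :
      halfCount ξ k ω = 1 / 2 * (#{b ∈ monoSurj n k | ω ∈ avoidEvent ξ b} : ℝ) := by
    rw [halfCount, ← sum_boole, Nat.add_sub_cancel, ← sum_monoSurj]
    refine congrArg (1 / 2 * ·) (sum_congr rfl fun b hb ↦ ?_)
    simp only [avoidEvent, Set.mem_ofPred_eq, walkHull_blockSums (mem_monoSurj.1 hb).1]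
    congr
  simp only [hcount]
  rw [integral_const_mul, integral_card_filter_mem hEx.nullMeasurableSet_avoidEvent]

theorem integral_halfCount (hBr : IsBridge P ξ) (hEx : IsExchangeable P ξ)
    (hGP : InGeneralPosition P ξ (min d n)) (hk : 1 ≤ k) :
    ∫ ω, halfCount ξ k ω ∂P =
      1 / ((k + 1).factorial : ℝ) * (n.choose k : ℝ) * (stirlingSum (k + 1) d : ℝ) := by
  have hperm (σ : Equiv.Perm (Fin (k + 1))) :
      ∑ b ∈ monoSurj n k, P.real (avoidEvent ξ (σ ∘ b)) =
        ∑ b ∈ monoSurj n k, P.real (avoidEvent ξ b) :=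
    sum_monoSurj_perm_comp (g := fun c ↦ P.real (avoidEvent ξ c))
      hEx.measureReal_avoidEvent_comp_perm σ
  have hsum : ((k + 1).factorial : ℝ) * ∑ b ∈ monoSurj n k, P.real (avoidEvent ξ b) =
      n.choose k * (2 * stirlingSum (k + 1) d) :=
    calc ((k + 1).factorial : ℝ) * ∑ b ∈ monoSurj n k, P.real (avoidEvent ξ b)
        = ∑ σ : Equiv.Perm (Fin (k + 1)), ∑ b ∈ monoSurj n k, P.real (avoidEvent ξ (σ ∘ b)) := by
          simp [hperm, Fintype.card_perm]
      _ = ∑ b ∈ monoSurj n k, (2 * stirlingSum (k + 1) d : ℝ) := by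
          rw [sum_comm]
          exact sum_congr rfl fun b hb ↦
            sum_perm_measureReal_avoidEvent hBr hEx hGP hk (mem_monoSurj.1 hb).2
      _ = n.choose k * (2 * stirlingSum (k + 1) d) := by
          rw [sum_const, card_monoSurj, nsmul_eq_mul]
  rw [integral_halfCount_eq_sum_measureReal_avoidEvent hEx]
  field_simp
  linarith

end Expectation

section CyclicShifts

variable {n : ℕ}

lemma card_filter_Icc_one {p : ℕ → Prop} [DecidablePred p] (h_zero : ¬ p 0) :
    #{i ∈ Icc 1 n | p i} = #{q : Fin (n + 1) | p q} := by
  rw [← card_map Fin.valEmbedding]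
  congr 1
  ext i
  simp only [mem_filter, mem_Icc, mem_map, mem_univ, true_and, Fin.valEmbedding_apply]
  constructor
  · rintro ⟨⟨-, hin⟩, hi⟩
    exact ⟨⟨i, Nat.lt_succ_of_le hin⟩, hi, rfl⟩
  · rintro ⟨q, hq, rfl⟩
    have hq_ne : q.val ≠ 0 := fun h ↦ h_zero (h ▸ hq)
    exact ⟨⟨Nat.one_le_iff_ne_zero.2 hq_ne, q.is_le⟩, hq⟩

section Group

variable {E : Type*} [AddCommGroup E] {y : Fin (n + 1) → E}

lemma prefixSum_val_add_one (hy : ∑ j, y j = 0) (p : Fin (n + 1)) :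
    prefixSum y (p + 1 : Fin (n + 1)) = prefixSum y p + y p := by
  rw [← prefixSum_add_one]
  rcases eq_or_ne p (Fin.last n) with rfl | hp
  · rw [Fin.last_add_one, Fin.val_last, prefixSum_of_le y le_rfl, hy]
    simp [prefixSum]
  · rw [Fin.val_add_one_of_lt (Fin.lt_last_iff_ne_last.2 hp)]

lemma prefixSum_comp_add_right (hy : ∑ j, y j = 0) (r q : Fin (n + 1)) :
    prefixSum (fun j ↦ y (j + r)) q = prefixSum y (q + r : Fin (n + 1)) - prefixSum y r := by
  induction q using Fin.induction with
  | zero => simp [prefixSum]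
  | succ q ih =>
    have hstep := prefixSum_add_one (fun j ↦ y (j + r)) q.castSucc
    rw [Fin.val_castSucc] at hstep ih
    rw [Fin.val_succ, hstep, ih, ← Fin.coeSucc_eq_succ, add_right_comm, prefixSum_val_add_one hy]
    abel

lemma IsGeneric.injective_prefixSum [Module ℝ E] {d : ℕ} (hy : IsGeneric d (relations y))
    (hd : 1 ≤ d) : Function.Injective fun q : Fin (n + 1) ↦ prefixSum y q := by
  refine .of_lt_imp_ne fun p q hpq heq ↦ ?_
  let w (j : Fin (n + 1)) : ℝ := (if j < q then 1 else 0) - if j < p then 1 else 0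
  have hrel : w ∈ relations y := by
    rw [mem_relations, ← sub_eq_zero.2 heq.symm]
    simp [w, sub_smul, prefixSum, sum_filter]
  have hrange : Set.range w ⊆ {0, 1} := by
    rintro _ ⟨j, rfl⟩
    by_cases hjp : j < p
    · simp [w, hjp, hjp.trans hpq]
    · by_cases hjq : j < q <;> simp [w, hjp, hjq]
  have hcard : (Set.range w).ncard ≤ d + 1 :=
    (Set.ncard_le_ncard hrange).trans ((Set.ncard_pair zero_ne_one).trans_le (by lia))
  have hconst := hy w hrel hcard p (Fin.last n)
  simp [w, hpq, (Fin.le_last _).not_gt] at hconst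

end Group

section LinearOrder

variable {α : Type*} [LinearOrder α]

lemma card_filter_lt_eq_symm {S : Fin (n + 1) → α} {σ : Equiv.Perm (Fin (n + 1))}
    (hσ : StrictAnti (S ∘ σ)) (r : Fin (n + 1)) : #{q | S r < S q} = (σ.symm r).val := by
  rw [← Fin.card_Iio]
  refine card_equiv σ.symm fun q ↦ ?_
  rw [mem_filter_univ, mem_Iio, ← hσ.lt_iff_gt]
  simp

lemma card_filter_card_lt_eq {S : Fin (n + 1) → α} (hS : Function.Injective S) {m : ℕ}
    (hm : m ≤ n) : #{r | #{q | S r < S q} = m} = 1 := by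
  obtain ⟨σ, hσ⟩ := exists_perm_strictAnti_comp hS
  simp only [card_filter_lt_eq_symm hσ]
  refine card_eq_one.2 ⟨σ ⟨m, Nat.lt_succ_of_le hm⟩, ext fun r ↦ ?_⟩
  rw [mem_filter_univ, mem_singleton, ← Equiv.symm_apply_eq, Fin.ext_iff]

variable [AddCommGroup α] [IsOrderedAddMonoid α]

/-- The number of positive sums among the proper nonempty prefix sums of `y`. -/
def posCount (y : Fin (n + 1) → α) : ℕ := #{i ∈ Icc 1 n | 0 < prefixSum y i}

lemma posCount_comp_add_right {y : Fin (n + 1) → α} (hy : ∑ j, y j = 0) (r : Fin (n + 1)) :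
    posCount (fun j ↦ y (j + r)) = #{q : Fin (n + 1) | prefixSum y r < prefixSum y q} := by
  rw [posCount, card_filter_Icc_one (by simp [prefixSum])]
  refine card_equiv (Equiv.addRight r) fun q ↦ ?_
  rw [mem_filter_univ, mem_filter_univ, prefixSum_comp_add_right hy, sub_pos]
  rfl

lemma card_filter_posCount_comp_add_right_eq {y : Fin (n + 1) → α} (hy : ∑ j, y j = 0)
    (hinj : Function.Injective fun q : Fin (n + 1) ↦ prefixSum y q) {m : ℕ} (hm : m ≤ n) :
    #{r | posCount (fun j ↦ y (j + r)) = m} = 1 := by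
  simp only [posCount_comp_add_right hy]
  exact card_filter_card_lt_eq hinj hm

end LinearOrder

end CyclicShifts

section Uniform

variable {d n : ℕ}

lemma measurable_posCount_coord (c : Fin d) :
    Measurable fun x : Fin (n + 1) → EuclideanSpace ℝ (Fin d) ↦ posCount fun j ↦ x j c := by
  simp only [posCount, card_filter]
  refine Finset.measurable_sum _ fun i _ ↦ Measurable.ite ?_ measurable_const measurable_const
  exact measurableSet_lt measurable_const
    ((continuous_prefixSum i).comp (by fun_prop : Continuous _)).measurable

lemma prefixSum_coord (x : Fin (n + 1) → EuclideanSpace ℝ (Fin d)) (c : Fin d) (i : ℕ) :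
    prefixSum (fun j ↦ x j c) i = prefixSum x i c := by
  simp [prefixSum]

lemma positiveCount_eq_posCount {Ω : Type*} (ξ : Fin (n + 1) → Ω → EuclideanSpace ℝ (Fin d))
    (c : Fin d) (ω : Ω) : positiveCount ξ c ω = posCount fun j ↦ ξ j ω c := by
  simp only [posCount, prefixSum_coord, positiveCount]
  rfl

lemma IsGeneric.injective_prefixSum_coord {x : Fin (n + 1) → EuclideanSpace ℝ (Fin 1)}
    (hx : IsGeneric 1 (relations x)) (c : Fin 1) :
    Function.Injective fun q : Fin (n + 1) ↦ prefixSum (fun j ↦ x j c) q := by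
  intro p q hpq
  simp only [prefixSum_coord] at hpq
  refine hx.injective_prefixSum le_rfl (PiLp.ext fun c' ↦ ?_)
  rwa [Subsingleton.elim c' c]

theorem measureReal_positiveCount_eq {Ω : Type*} [MeasurableSpace Ω] {P : Measure Ω}
    [IsProbabilityMeasure P] {ξ : Fin (n + 1) → Ω → EuclideanSpace ℝ (Fin 1)} (hBr : IsBridge P ξ)
    (hEx : IsExchangeable P ξ) (hGP : InGeneralPosition P ξ (min 1 n)) (c : Fin 1) {m : ℕ}
    (hm : m ≤ n) : P.real {ω | positiveCount ξ c ω = m} = 1 / (n + 1) := by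
  let A (r : Fin (n + 1)) : Set Ω := {ω | posCount (fun j ↦ ξ (j + r) ω c) = m}
  have hset : MeasurableSet
      {x : Fin (n + 1) → EuclideanSpace ℝ (Fin 1) | posCount (fun j ↦ x j c) = m} :=
    measurable_posCount_coord c (measurableSet_singleton m)
  have hnull (r : Fin (n + 1)) : NullMeasurableSet (A r) P :=
    (hEx (Equiv.addRight r)).aemeasurable_fst.nullMeasurableSet_preimage hset
  have hshift (r : Fin (n + 1)) : P.real (A r) = P.real {ω | positiveCount ξ c ω = m} := by
    simp only [positiveCount_eq_posCount]
    exact congrArg ENNReal.toReal ((hEx (Equiv.addRight r)).measure_mem_eq hset)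
  have hcount : ∀ᵐ ω ∂P, #{r | ω ∈ A r} = 1 := by
    filter_upwards [hBr.ae_sum_eq_zero, hBr.ae_isGeneric hEx hGP] with ω hsum hgen
    have hsum_coord : ∑ j, ξ j ω c = 0 := by
      simpa using congrArg (fun v : EuclideanSpace ℝ (Fin 1) ↦ v c) hsum
    exact card_filter_posCount_comp_add_right_eq hsum_coord (hgen.injective_prefixSum_coord c) hm
  have htotal := sum_measureReal_eq_of_ae_card_eq hnull hcount
  simp only [hshift, sum_const, card_univ, Fintype.card_fin, nsmul_eq_mul] at htotal
  rw [eq_div_iff (by positivity), mul_comm]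
  exact_mod_cast htotal

end Uniform

end RandomBridge

theorem theorem1p6 {Ω : Type*} [MeasurableSpace Ω] (P : MeasureTheory.Measure Ω)
    [MeasureTheory.IsProbabilityMeasure P] (d n : ℕ) (hn : d + 2 ≤ n)
    (ξ : Fin n → Ω → EuclideanSpace ℝ (Fin d)) (hξ : ∀ i, Measurable (ξ i))
    (hBr : RandomBridge.IsBridge P ξ) (hEx : RandomBridge.IsExchangeable P ξ)
    (hGP : RandomBridge.InGeneralPosition P ξ d) :
    (∀ k : ℕ, 1 ≤ k → k ≤ n - 1 →
      (∫ ω, RandomBridge.halfCount ξ k ω ∂P =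
        1 / ((k + 1).factorial : ℝ) * ((n - 1).choose k : ℝ) *
          (RandomBridge.stirlingSum (k + 1) d : ℝ)) ∧
      -- `M_{k+1,k}` is formed from any random bridge of length `k + 1` in general position
      (∀ {Ω' : Type*} [MeasurableSpace Ω'] (P' : MeasureTheory.Measure Ω')
        [MeasureTheory.IsProbabilityMeasure P']
        (η : Fin (k + 1) → Ω' → EuclideanSpace ℝ (Fin d)), (∀ i, Measurable (η i)) →
        RandomBridge.IsBridge P' η → RandomBridge.IsExchangeable P' η →
        RandomBridge.InGeneralPosition P' η (min d k) →
        ∫ ω, RandomBridge.halfCount ξ k ω ∂P =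
          ((n - 1).choose k : ℝ) * ∫ ω, RandomBridge.halfCount η k ω ∂P')) ∧
    -- in dimension one, the number of positive terms is uniform on `{0, …, n - 1}`
    (d = 1 → ∀ c : Fin d, ∀ m : ℕ, m ≤ n - 1 →
      P.real {ω | RandomBridge.positiveCount ξ c ω = m} = 1 / (n : ℝ)) := by
  obtain ⟨l, rfl⟩ : ∃ l, n = l + 1 := ⟨n - 1, by lia⟩
  have hGP' : RandomBridge.InGeneralPosition P ξ (min d l) := by rwa [min_eq_left (by lia)]
  rw [Nat.add_sub_cancel]
  refine ⟨fun k hk _ ↦ ?_, ?_⟩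
  · have hmean := RandomBridge.integral_halfCount hBr hEx hGP' hk
    refine ⟨hmean, fun P' _ η _ hBrη hExη hGPη ↦ ?_⟩
    rw [hmean, RandomBridge.integral_halfCount hBrη hExη hGPη hk, Nat.choose_self]
    push_cast
    ring
  · rintro rfl c m hm
    rw [Nat.cast_add_one]
    exact RandomBridge.measureReal_positiveCount_eq hBr hEx hGP' c hm
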